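/- **Setting.** Let $\mathrm{Vect}$ be the Banach space of $C^3$ vector fields on $S^2$, and let $\widehat{\mathrm{Vect}}$ be the Banach manifold of pairs consisting of $v\in\mathrm{Vect}$ and a marking of $v$: an ordered tuple of $N$ distinct hyperbolic saddles $S_1,\dots,S_N$ and a numbering $\gamma_{i,1},\dots,\gamma_{i,4}$ of the four local separatrices of each $S_i$ (the charts are local inverses of the map forgetting the marking, which is a local homeomorphism to $\mathrm{Vect}$). Two marked fields $v,w$ are *equivalent* (orbitally topologically equivalent with $Sep$-tracking) if there is an orientation preserving homeomorphism of $S^2$ that maps phase curves of $v$ to phase curves of $w$ with their time orientation, and each marked saddle and each marked local separatrix of $v$ to the corresponding one of $w$. A *$k$-parameter local family* $V=\{v_\alpha\}$ is a germ of a continuous map $(\mathbb R^k,0)\to(\widehat{\mathrm{Vect}},v_0)$ such that $v_\alpha(x)$ is $C^3$ in $(\alpha,x)$. Families $V,\tilde V$ are *equivalent* if there is a germ of a homeomorphism $h\colon(\mathbb R^k,0)\to(\mathbb R^k,0)$ such that $v_\alpha$ and $\tilde v_{h(\alpha)}$ are equivalent for all small $\alpha$. *Smoothness.* Fix a dense linear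 subspace $\mathcal D\subset\mathrm{Vect}$ (for instance $\mathcal D=\mathrm{Vect}$, or the space of $C^\infty$ vector fields). A map $G$ from a neighbourhood of $v_0\in\mathrm{Vect}$ to $\mathbb R^n$ is called *smooth near $v_0$* if it is $C^1$ near $v_0$ and, in a neighbourhood of $v_0$, its restrictions to all families $c\mapsto u+\sum_{i=1}^l c_iw_i$ with $u,w_i\in\mathcal D$ are $C^3$. (Every $C^3$ map is smooth.) A *submanifold* $\mathbb M\subset\widehat{\mathrm{Vect}}$ of codimension $m$ is a set given near each of its points, in the charts, by an equation $F=0$ with $F$ smooth with values in $\mathbb R^m$ and $dF$ onto at that point; $T_v\mathbb M=\ker dF(v)$. A function on $\mathbb M$ is *smooth* if locally it is the restriction of a smooth function. For $k\ge m$ let $\mathbb M^{\pitchfork,k}$ be the set of $k$-parameter local families $V$ with $v_0\in\mathbb M$ that are $C^1$ as maps to $\widehat{\mathrm{Vect}}$ and transverse to $\mathbb M$ at $v_0$. $\mathbb M$ is *topologically distinguished* if it has an open neighbourhood $\mathcal U$ such that no $v\in\mathbb M$ is equivalent to any $w\in\mathcal U\setminus\mathbb M$. A function $\varphi\colon\mathbb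 M\to\mathbb R$ is *robustly invariant* if $\varphi(v_0)=\varphi(\tilde v_0)$ for all $k\ge m$ and all equivalent $V,\tilde V\in\mathbb M^{\pitchfork,k}$. Smooth functions $\varphi_1,\dots,\varphi_D$ on $\mathbb M$ are *independent* if the differential of $\Phi=(\varphi_1,\dots,\varphi_D)\colon\mathbb M\to\mathbb R^D$ has rank $D$ at every point of $\mathbb M$. The classification of families from $\mathbb M^{\pitchfork,k}$ *admits a functional invariant of rank $(d,D)$* if to each $V\in\mathbb M^{\pitchfork,k}$ one can assign a germ of a $d$-dimensional $C^1$ submanifold $(S_V,0)\subset(\mathbb R^k,0)$ and a germ of a $C^1$ map $f_V\colon(S_V,0)\to\mathbb R^D$ such that * if $V,\tilde V\in\mathbb M^{\pitchfork,k}$ are equivalent, then there is a local homeomorphism $\chi\colon(S_V,0)\to(S_{\tilde V},0)$ with $f_{\tilde V}\circ\chi=f_V$; * there is a non-empty open set $U\subset\mathbb R^D$ such that for every germ of a $C^3$ map $f\colon(S,0)\to\mathbb R^D$ on a $d$-dimensional $C^3$ submanifold germ $(S,0)\subset(\mathbb R^k,0)$ with $f(0)\in U$ there are $V\in\mathbb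 M^{\pitchfork,k}$ and a local homeomorphism $\chi\colon(S,0)\to(S_V,0)$ with $f_V\circ\chi=f$. **Proposition.** Let $\mathbb M\subset\widehat{\mathrm{Vect}}$ be a non-empty topologically distinguished submanifold of finite codimension $m$ that has $D>1$ independent smooth robustly invariant functions $\varphi_1,\dots,\varphi_D$. Let $0<d<D$ and $k=d+m$. Then the classification of families from $\mathbb M^{\pitchfork,k}$ admits a functional invariant of rank $(d,D)$. Namely, $S_V=V^{-1}(\mathbb M)=\{\alpha : v_\alpha\in\mathbb M\}$ and $f_V(\alpha)=\Phi(v_\alpha)$ is such an invariant. -/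

import Mathlib

open Filter Topology Metric
open scoped Manifold ContDiff

namespace PlanarFamilies

noncomputable section

/-! ### The Banach space of `C³` vector fields on the two-sphere -/

/-- Euclidean three-space. -/
abbrev E3 : Type := EuclideanSpace ℝ (Fin 3)

/-- The two-sphere. -/
abbrev S2 : Type := sphere (0 : E3) 1

instance : Fact (Module.finrank ℝ E3 = 2 + 1) := ⟨by simp⟩

/-- `ℝⁿ` with its Euclidean norm. -/
abbrev Rn (n : ℕ) : Type := EuclideanSpace ℝ (Fin n)

/-- The `C³` tangent vector fields on the sphere, seen as `E3`-valued `C³` maps `v` with `v x`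
orthogonal to `x`. -/
def fieldSubmodule : Submodule ℝ (S2 → E3) where
  carrier := {v | ContMDiff (𝓡 2) 𝓘(ℝ, E3) 3 v ∧ ∀ x : S2, inner ℝ (v x) (x : E3) = 0}
  zero_mem' := ⟨contMDiff_const, fun x => by simp⟩
  add_mem' := fun {a b} ha hb =>
    ⟨ha.1.add hb.1, fun x => by simp [inner_add_left, ha.2 x, hb.2 x]⟩
  smul_mem' := fun c a ha =>
    ⟨(contDiff_const_smul (F := E3) c).contMDiff.comp ha.1,
      fun x => by simp [inner_smul_left, ha.2 x]⟩

/-- The space of `C³` vector fields on `S²` (with the `C³` topology introduced below, not with the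
topology of pointwise convergence). -/
def Vect : Type := fieldSubmodule

instance : AddCommGroup Vect := inferInstanceAs (AddCommGroup fieldSubmodule)

instance : Module ℝ Vect := inferInstanceAs (Module ℝ fieldSubmodule)

/-- The value of a vector field at a point. -/
def Vect.eval (v : Vect) (x : S2) : E3 := v.1 x

instance : CoeFun Vect (fun _ => S2 → E3) := ⟨Vect.eval⟩

lemma Vect.contMDiff (v : Vect) : ContMDiff (𝓡 2) 𝓘(ℝ, E3) 3 (fun x => v x) :=
  (Subtype.property (p := fun f => f ∈ fieldSubmodule) v).1

lemma Vect.ext_of_eval {v w : Vect} (h : ∀ x, v x = w x) : v = w :=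
  Subtype.ext (funext h)

lemma Vect.eval_add (v w : Vect) (x : S2) : (v + w) x = v x + w x := rfl

lemma Vect.eval_smul (c : ℝ) (v : Vect) (x : S2) : (c • v) x = c • v x := rfl

/-- A base point on the sphere, needed only to give the radial projection a value at the origin. -/
def basePoint : S2 := ⟨EuclideanSpace.single 0 1, by simp⟩

open Classical in
/-- The radial projection `y ↦ y / ‖y‖` of `E3 \ {0}` onto the sphere. -/
def radial (y : E3) : S2 :=
  if h : y ≠ 0 then ⟨‖y‖⁻¹ • y, by simp [norm_smul, h]⟩ else basePoint

/-- The extension of a vector field from the sphere to `E3 \ {0}` that is constant along rays. -/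
def Vect.ext (v : Vect) (y : E3) : E3 := v (radial y)

lemma radial_coe (x : S2) : radial (x : E3) = x := by
  have hx : ‖(x : E3)‖ = 1 := by simp
  have h0 : (x : E3) ≠ 0 := fun h => by simp [h] at hx
  apply Subtype.ext
  simp [radial, h0]

lemma Vect.ext_coe (v : Vect) (x : S2) : v.ext x = v x := by
  simp [Vect.ext, radial_coe]

lemma contMDiffAt_radial {y : E3} (hy : y ≠ 0) :
    ContMDiffAt 𝓘(ℝ, E3) (𝓡 2) 3 radial y := by
  let U : TopologicalSpace.Opens E3 := ⟨{0}ᶜ, isOpen_compl_singleton⟩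
  have hU : ∀ z : U, ‖(z : E3)‖ ≠ 0 := fun z => norm_ne_zero_iff.2 z.2
  have h1 : ContMDiff 𝓘(ℝ, E3) 𝓘(ℝ, E3) 3 (fun z : U => ‖(z : E3)‖⁻¹ • (z : E3)) := by
    intro z
    have : ContDiffAt ℝ 3 (fun w : E3 => ‖w‖⁻¹ • w) (z : E3) :=
      ((contDiffAt_norm ℝ z.2).inv (hU z)).smul contDiffAt_id
    exact (contMDiffAt_subtype_iff (U := U) (f := fun w : E3 => ‖w‖⁻¹ • w)).2
      this.contMDiffAt
  have h2 := h1.codRestrict_sphere (n := 2) (E := E3)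
    (fun z => by simp [norm_smul, hU z])
  have h3 : ContMDiffAt 𝓘(ℝ, E3) (𝓡 2) 3 (fun z : U => radial z) ⟨y, hy⟩ := by
    refine (h2 ⟨y, hy⟩).congr_of_eventuallyEq (Eventually.of_forall fun z => ?_)
    have hz : (z : E3) ≠ 0 := z.2
    apply Subtype.ext
    simp [radial, hz]
  exact (contMDiffAt_subtype_iff (U := U) (f := radial) (x := ⟨y, hy⟩)).1 h3

lemma Vect.contDiffAt_ext (v : Vect) {y : E3} (hy : y ≠ 0) : ContDiffAt ℝ 3 v.ext y :=
  (ContMDiffAt.comp (I' := 𝓡 2) y (v.contMDiff (radial y)) (contMDiffAt_radial hy)).contDiffAt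

lemma coe_ne_zero (x : S2) : (x : E3) ≠ 0 := fun h => by
  have hx : ‖(x : E3)‖ = 1 := by simp
  simp [h] at hx

/-- The jet of order at most three of a vector field along the sphere. -/
def Vect.jet : Vect →ₗ[ℝ] ((i : Fin 4) → C(S2, E3 [×(i : ℕ)]→L[ℝ] E3)) where
  toFun v i :=
    { toFun := fun x => iteratedFDeriv ℝ i v.ext x
      continuous_toFun := by
        refine continuous_iff_continuousAt.2 fun x => ?_
        have h : ContDiffAt ℝ 3 v.ext (x : E3) := v.contDiffAt_ext (coe_ne_zero x)
        have hi : ((i : ℕ) : ℕ∞ω) ≤ 3 := by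
          have := i.2
          exact_mod_cast Nat.lt_succ_iff.1 this
        have := (h.iteratedFDeriv_right (m := 0) (i := i) (by simpa using hi)).continuousAt
        exact ContinuousAt.comp (f := ((↑) : S2 → E3)) this continuous_subtype_val.continuousAt }
  map_add' v w := by
    funext i
    ext1 x
    have hi : ((i : ℕ) : ℕ∞ω) ≤ 3 := by
      have := i.2
      exact_mod_cast Nat.lt_succ_iff.1 this
    have hv := (v.contDiffAt_ext (coe_ne_zero x)).of_le hi
    have hw := (w.contDiffAt_ext (coe_ne_zero x)).of_le hi
    exact iteratedFDeriv_add_apply (f := v.ext) (g := w.ext) hv hw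
  map_smul' c v := by
    funext i
    ext1 x
    have hi : ((i : ℕ) : ℕ∞ω) ≤ 3 := by
      have := i.2
      exact_mod_cast Nat.lt_succ_iff.1 this
    have hv := (v.contDiffAt_ext (coe_ne_zero x)).of_le hi
    exact iteratedFDeriv_const_smul_apply (f := v.ext) hv

lemma Vect.jet_injective : Function.Injective Vect.jet := by
  intro v w h
  refine Vect.ext_of_eval fun x => ?_
  have h0 := congrArg (fun J => (J 0 x) (fun _ => 0)) h
  have h1 : v.ext x = w.ext x := by simpa [Vect.jet] using h0
  simpa [Vect.ext_coe] using h1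

/-- The `C³` norm: the largest of the suprema over the sphere of the norms of the derivatives of
order `0, 1, 2, 3` of the ray-constant extension. -/
instance : NormedAddCommGroup Vect :=
  NormedAddCommGroup.induced Vect _ Vect.jet Vect.jet_injective

instance : NormedSpace ℝ Vect := NormedSpace.induced ℝ Vect _ Vect.jet

/-! ### Hyperbolic saddles, local separatrices, marked vector fields -/

/-- The differential of `v` at `p`. If `v p = 0`, it maps the tangent plane of the sphere at `p` to
itself and is there the linearization of `v`. -/
def Vect.linearization (v : Vect) (p : S2) : E3 →L[ℝ] E3 := fderiv ℝ v.ext p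

/-- `p` is a hyperbolic saddle of `v`: a zero of `v` such that the linearization on the tangent
plane has a negative and a positive eigenvalue. -/
def IsHyperbolicSaddle (v : Vect) (p : S2) : Prop :=
  v p = 0 ∧ ∃ (a b : E3) (lam mu : ℝ),
    a ≠ 0 ∧ b ≠ 0 ∧ inner ℝ a (p : E3) = 0 ∧ inner ℝ b (p : E3) = 0 ∧
    v.linearization p a = lam • a ∧ v.linearization p b = mu • b ∧ lam < 0 ∧ 0 < mu

/-- `e` is the tangent direction of one of the local separatrices of the saddle `p` of `v`: a unit
tangent eigenvector of the linearization. A hyperbolic saddle has exactly four of them, two stable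
and two unstable, and they correspond one-to-one to its four local separatrices: the local
separatrix of direction `e` is the germ at `p` of the phase curve that tends to `p` (as `t → +∞` or
as `t → -∞`) tangentially to `e`. -/
def IsSeparatrixDirection (v : Vect) (p : S2) (e : E3) : Prop :=
  ‖e‖ = 1 ∧ inner ℝ e (p : E3) = 0 ∧ ∃ lam : ℝ, v.linearization p e = lam • e

/-- A vector field with an ordered tuple of `N` distinct marked hyperbolic saddles and, for each of
them, its four marked (that is, numbered) local separatrices, given by their directions. -/
structure MarkedField (N : ℕ) where
  /-- the vector field -/
  field : Vect
  /-- the marked saddles -/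
  saddle : Fin N → S2
  /-- the directions of the marked separatrices -/
  dir : Fin N → Fin 4 → E3
  saddle_injective : Function.Injective saddle
  isHyperbolicSaddle : ∀ i, IsHyperbolicSaddle field (saddle i)
  dir_injective : ∀ i, Function.Injective (dir i)
  isSeparatrixDirection : ∀ i j, IsSeparatrixDirection field (saddle i) (dir i j)

/-- The topology of the space of marked fields: the field in the `C³` topology, together with the
saddles and the separatrices. For this topology `MarkedField.field` is a local homeomorphism onto an
open subset of `Vect`; its local inverses are the charts of the Banach manifold of marked fields. -/
instance (N : ℕ) : TopologicalSpace (MarkedField N) :=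
  TopologicalSpace.induced (fun v => (v.field, v.saddle, v.dir)) inferInstance

/-! ### Orbital topological equivalence with tracking of separatrices -/

/-- `x` is a (complete) trajectory of `v`. -/
def IsTrajectory (v : Vect) (x : ℝ → S2) : Prop :=
  ∀ t, HasDerivAt (fun s => (x s : E3)) (v (x t)) t

/-- Along the filter `l` (one of `atTop`, `atBot`) the curve `x` tends to `p` tangentially to the
direction `e`; so a trajectory `x` near this end represents the local separatrix of the saddle `p`
with direction `e`. -/
def EndsAlong (x : ℝ → S2) (l : Filter ℝ) (p : S2) (e : E3) : Prop :=
  Tendsto x l (𝓝 p) ∧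
    Tendsto (fun t => ‖(x t : E3) - p‖⁻¹ • ((x t : E3) - p)) l (𝓝 e)

/-- `H` maps every phase curve of `v` onto a phase curve of `w`, preserving the direction of time:
up to an increasing change of time, it maps trajectories to trajectories. -/
def MapsPhaseCurves (v w : Vect) (H : S2 → S2) : Prop :=
  ∀ x, IsTrajectory v x → ∃ τ : ℝ ≃o ℝ, IsTrajectory w (H ∘ x ∘ τ)

open CategoryTheory in
/-- A homeomorphism of the sphere preserves orientation if it acts as the identity on the second
integral singular homology group, i.e. if it has degree one. -/
def OrientationPreserving (H : S2 ≃ₜ S2) : Prop :=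
  ((AlgebraicTopology.singularHomologyFunctor (ModuleCat.{0} ℤ) 2).obj (ModuleCat.of ℤ ℤ)).map
    (TopCat.ofHom (H : C(S2, S2))) = 𝟙 _

/-- Orbital topological equivalence with `Sep`-tracking. -/
def SepEquivalent {N : ℕ} (v w : MarkedField N) : Prop :=
  ∃ H : S2 ≃ₜ S2, OrientationPreserving H ∧
    MapsPhaseCurves v.field w.field H ∧ MapsPhaseCurves w.field v.field H.symm ∧
    (∀ i, H (v.saddle i) = w.saddle i) ∧
    ∀ i j x, IsTrajectory v.field x →
      (EndsAlong x atTop (v.saddle i) (v.dir i j) ↔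
        EndsAlong (H ∘ x) atTop (w.saddle i) (w.dir i j)) ∧
      (EndsAlong x atBot (v.saddle i) (v.dir i j) ↔
        EndsAlong (H ∘ x) atBot (w.saddle i) (w.dir i j))

/-! ### Local families

A germ at `0` is given by a representative defined on all of `ℝᵏ`; only its values near `0`
matter. -/

/-- `V` represents a `k`-parameter local family of marked fields: near `0` it is a continuous map
to the space of marked fields, and `V α x` is `C³` in `(α, x)`. -/
def IsLocalFamily {N k : ℕ} (V : Rn k → MarkedField N) : Prop :=
  (∀ᶠ α in 𝓝 (0 : Rn k), ContinuousAt V α) ∧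
  ∀ᶠ α in 𝓝 (0 : Rn k), ∀ x : S2,
    ContMDiffAt (𝓘(ℝ, Rn k).prod (𝓡 2)) 𝓘(ℝ, E3) 3
      (fun p : Rn k × S2 => (V p.1).field p.2) (α, x)

/-- Weak topological equivalence with `Sep`-tracking of local families. -/
def FamiliesEquivalent {N k : ℕ} (V V' : Rn k → MarkedField N) : Prop :=
  ∃ h : OpenPartialHomeomorph (Rn k) (Rn k), (0 : Rn k) ∈ h.source ∧ h 0 = 0 ∧
    ∀ᶠ α in 𝓝 (0 : Rn k), SepEquivalent (V α) (V' (h α))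

/-! ### Submanifolds of the Banach manifold of marked fields -/

/-- Near the marked field `v`, the set `M` is the zero set of the composition of the projection to
`Vect` with the `C¹` map `F`, whose differential at `v` is onto `ℝᵐ`. The tangent space of `M` at `v`
is then the kernel of this differential. -/
def IsDefiningMap {N : ℕ} (M : Set (MarkedField N)) (m : ℕ) (v : MarkedField N)
    (F : Vect → Rn m) : Prop :=
  ContDiffAt ℝ 1 F v.field ∧ Function.Surjective (fderiv ℝ F v.field) ∧
    ∀ᶠ w in 𝓝 v, w ∈ M ↔ F w.field = 0

/-- Smoothness of a map `G` near the vector field `v₀`, relative to a linear space `𝒟` of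
vector fields: `G` is `C¹` near `v₀`, and in a neighbourhood of `v₀` it is `C³` along every
finite-parameter affine family of fields from `𝒟`. For `𝒟 = ⊤` every `C³` map has this property.
If `𝒟` consists of the `C^∞` fields, so have the eigenvalues at a saddle, although they
are not `C³` functions on `Vect`. -/
def SmoothNear (𝒟 : Submodule ℝ Vect) {n : ℕ} (G : Vect → Rn n) (v₀ : Vect) : Prop :=
  ContDiffAt ℝ 1 G v₀ ∧ ∃ W ∈ 𝓝 v₀, ∀ (l : ℕ) (u : Vect) (w : Fin l → Vect),
    u ∈ 𝒟 → (∀ i, w i ∈ 𝒟) →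
    ∀ c : Rn l, u + ∑ i, c i • w i ∈ W →
      ContDiffAt ℝ 3 (fun c : Rn l => G (u + ∑ i, c i • w i)) c

/-- `M` is a smooth Banach submanifold of codimension `m`. -/
def IsBanachSubmanifold {N : ℕ} (𝒟 : Submodule ℝ Vect) (M : Set (MarkedField N)) (m : ℕ) : Prop :=
  ∀ v ∈ M, ∃ F : Vect → Rn m, SmoothNear 𝒟 F v.field ∧ IsDefiningMap M m v F

/-- `M` is topologically distinguished (in some open neighbourhood `𝒰` of it). -/
def TopologicallyDistinguished {N : ℕ} (M : Set (MarkedField N)) : Prop :=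
  ∃ 𝒰 : Set (MarkedField N), IsOpen 𝒰 ∧ M ⊆ 𝒰 ∧
    ∀ v ∈ M, ∀ w ∈ 𝒰 \ M, ¬ SepEquivalent v w

/-- The map `V` to the Banach manifold of marked fields is `C¹` near `0`, starts on `M`, and is
transverse to `M` at `V 0`: the image of its differential and the tangent space of `M` span the
whole space. -/
def IsTransverse {N k : ℕ} (M : Set (MarkedField N)) (m : ℕ) (V : Rn k → MarkedField N) : Prop :=
  V 0 ∈ M ∧ ContDiffAt ℝ 1 (fun α => (V α).field) 0 ∧
    ∃ F : Vect → Rn m, IsDefiningMap M m (V 0) F ∧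
      ∀ w : Vect, ∃ (a : Rn k) (u : Vect), fderiv ℝ F (V 0).field u = 0 ∧
        w = fderiv ℝ (fun α => (V α).field) 0 a + u

/-- The `k`-parameter local families that start on `M` and are transverse to `M`, where `M` has
codimension `m`. -/
def transverseFamilies {N : ℕ} (M : Set (MarkedField N)) (m k : ℕ) :
    Set (Rn k → MarkedField N) :=
  {V | IsLocalFamily V ∧ IsTransverse M m V}

/-- `φ` (of which only the values on `M` matter) is a robustly invariant function on `M`. -/
def RobustlyInvariant {N : ℕ} (M : Set (MarkedField N)) (m : ℕ) (φ : MarkedField N → ℝ) : Prop :=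
  ∀ k, m ≤ k → ∀ V ∈ transverseFamilies M m k, ∀ V' ∈ transverseFamilies M m k,
    FamiliesEquivalent V V' → φ (V 0) = φ (V' 0)

/-- The vector function with the given components. -/
def vectorOf {N D : ℕ} (φ : Fin D → MarkedField N → ℝ) (v : MarkedField N) : Rn D :=
  WithLp.toLp 2 (fun j => φ j v)

/-- The functions `φ j` are smooth on `M` and independent: the differential of
`Φ = (φ₁, …, φ_D)`, defined on the tangent space of `M`, has rank `D` at every point of `M`. Here `G`
is a smooth local extension of `Φ`, and `F` a smooth local defining map of `M`. -/
def IndependentOn {N D : ℕ} (𝒟 : Submodule ℝ Vect) (M : Set (MarkedField N)) (m : ℕ)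
    (φ : Fin D → MarkedField N → ℝ) : Prop :=
  ∀ v ∈ M, ∃ (F : Vect → Rn m) (G : Vect → Rn D),
    SmoothNear 𝒟 F v.field ∧ IsDefiningMap M m v F ∧ SmoothNear 𝒟 G v.field ∧
    (∀ᶠ w in 𝓝 v, w ∈ M → vectorOf φ w = G w.field) ∧
    ∀ y : Rn D, ∃ u : Vect, fderiv ℝ F v.field u = 0 ∧ fderiv ℝ G v.field u = y

/-! ### Functional invariants -/

/-- The germ of the set `S` at `0` is a `d`-dimensional submanifold of `ℝᵏ` through `0`, of
class `C^r`. -/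
def IsSubmanifoldGerm {k : ℕ} (r : ℕ∞ω) (d : ℕ) (S : Set (Rn k)) : Prop :=
  (0 : Rn k) ∈ S ∧ ∃ c : ℕ, d + c = k ∧ ∃ F : Rn k → Rn c,
    ContDiffAt ℝ r F 0 ∧ Function.Surjective (fderiv ℝ F 0) ∧
    ∀ᶠ α in 𝓝 (0 : Rn k), α ∈ S ↔ F α = 0

/-- The germ at `0` of the restriction of `f` to `S` is of class `C^r`. -/
def IsSmoothGermOn {k D : ℕ} (r : ℕ∞ω) (S : Set (Rn k)) (f : Rn k → Rn D) : Prop :=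
  ∃ g : Rn k → Rn D, ContDiffAt ℝ r g 0 ∧ ∀ᶠ α in 𝓝[S] (0 : Rn k), f α = g α

/-- The germs `f : (S, 0) → ℝᴰ` and `f' : (S', 0) → ℝᴰ` coincide up to a local homeomorphism
`χ : (S, 0) → (S', 0)` of the domains: `f' ∘ χ = f`. -/
def GermEquivalent {k D : ℕ} (S : Set (Rn k)) (f : Rn k → Rn D)
    (S' : Set (Rn k)) (f' : Rn k → Rn D) : Prop :=
  ∃ χ : PartialEquiv (Rn k) (Rn k),
    χ.source ⊆ S ∧ χ.source ∈ 𝓝[S] 0 ∧ χ.target ⊆ S' ∧ χ.target ∈ 𝓝[S'] 0 ∧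
    ContinuousOn χ χ.source ∧ ContinuousOn χ.symm χ.target ∧
    χ 0 = 0 ∧ ∀ α ∈ χ.source, f' (χ α) = f α

/-- The assignment `V ↦ (f V : (S V, 0) → ℝᴰ)` is a functional invariant of rank `(d, D)` of the
classification of the local families in the class `𝓥`:
* the germ `f V` is defined on a `d`-dimensional submanifold germ `S V` of the parameter space
  (both of class `C¹`);
* equivalent families have germs that coincide up to a homeomorphism of the domain;
* for some non-empty open set `U` of `ℝᴰ`, every (`C³`) germ of a map from a `d`-dimensional
  submanifold germ to `ℝᴰ` with value at `0` in `U` is realized, up to a homeomorphism of the domain,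
  by some family of the class. -/
def IsFunctionalInvariant {N k : ℕ} (𝓥 : Set (Rn k → MarkedField N)) (d D : ℕ)
    (S : (Rn k → MarkedField N) → Set (Rn k))
    (f : (Rn k → MarkedField N) → Rn k → Rn D) : Prop :=
  (∀ V ∈ 𝓥, IsSubmanifoldGerm 1 d (S V) ∧ IsSmoothGermOn 1 (S V) (f V)) ∧
  (∀ V ∈ 𝓥, ∀ V' ∈ 𝓥, FamiliesEquivalent V V' →
    GermEquivalent (S V) (f V) (S V') (f V')) ∧
  ∃ U : Set (Rn D), IsOpen U ∧ U.Nonempty ∧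
    ∀ (T : Set (Rn k)) (g : Rn k → Rn D),
      IsSubmanifoldGerm 3 d T → IsSmoothGermOn 3 T g → g 0 ∈ U →
      ∃ V ∈ 𝓥, GermEquivalent T g (S V) (f V)

/-- The classification of the local families in the class `𝓥` admits a functional invariant of
rank `(d, D)`. -/
def AdmitsFunctionalInvariant {N k : ℕ} (𝓥 : Set (Rn k → MarkedField N)) (d D : ℕ) : Prop :=
  ∃ S f, IsFunctionalInvariant 𝓥 d D S f

end

end PlanarFamilies

open PlanarFamilies

/-!
Let `F` be a local defining map of `M` and `G` a local extension of `Φ = (φ₁, …, φ_D)`, both defined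
on an open set of `Vect`.

*The germs.* For a transverse family `V`, the map `α ↦ F (V α)` is a submersion, so `V⁻¹(M)` is a
submanifold germ, and `α ↦ G (V α)` extends `Φ ∘ V`.

*Invariance* (`germEquivalent_of_familiesEquivalent`). If `h` is an equivalence of `V` and `V'`,
then `V α` and `V' (h α)` are equivalent fields close to `M`, and since `M` is topologically
distinguished, either both or neither of them lie on `M`. Here the symmetry of the equivalence
relation is needed. Hence `h` restricts to a homeomorphism of `V⁻¹(M)` onto `V'⁻¹(M)`. Transversality
is an open condition, so at a nearby `β ∈ V⁻¹(M)` the translated families `V (β + ·)` and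
`V' (h β + ·)` are again transverse, and equivalent by translating `h`. Robust invariance, applied to
them, gives `Φ (V β) = Φ (V' (h β))`.

*Realization* (`exists_open_forall_realized`). The pair `P = (F, G)` is a submersion at a point of
`M`, because `dG` is onto on the kernel of `dF`. By density of `𝒟` there are directions `wᵢ ∈ 𝒟` and
an origin `u ∈ 𝒟` such that `c ↦ P (u + ∑ cᵢ wᵢ)` attains the value `(0, y)`, for every `y` in an
open set `U`, at a point where it is a local diffeomorphism (`exists_affine_family`); it is `C³` by the definition of
smoothness relative to `𝒟`. Given a submanifold germ `{f = 0}` and a `C³` map `g` with `g 0 ∈ U`,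
solving `P (u + ∑ cᵢ(α) wᵢ) = (f α, g α)` for `c(α)` gives a family of fields `V` with
`V⁻¹(M) = {f = 0}` and `Φ ∘ V = g` there.

The fields of this family have to be marked, continuously in `α`. A marking of one field extends
to nearby fields (`MarkedField.exists_section`), since saddles and unit eigenvectors are
nondegenerate solutions of equations in finite-dimensional unknowns. These equations, and the one
that determines `u` and `U`, are solved by `exists_continuousAt_implicit`, which needs no
completeness of the space of parameters.
-/

namespace PlanarFamilies

/-! ### Surjective differentials and an implicit function theorem -/

/-- Surjectivity onto a finite-dimensional space is an open condition: if `L₀ ∘ R = id`, then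
`L ∘ R` is invertible for `L` near `L₀`. -/
lemma eventually_surjective {E F : Type*} [NormedAddCommGroup E] [NormedSpace ℝ E]
    [NormedAddCommGroup F] [NormedSpace ℝ F] [FiniteDimensional ℝ F] {L₀ : E →L[ℝ] F}
    (h : Function.Surjective L₀) : ∀ᶠ L : E →L[ℝ] F in 𝓝 L₀, Function.Surjective L := by
  have : CompleteSpace F := FiniteDimensional.complete ℝ F
  obtain ⟨R, hR⟩ := (L₀ : E →ₗ[ℝ] F).exists_rightInverse_of_surjective (LinearMap.range_eq_top.2 h)
  let R' : F →L[ℝ] E := R.toContinuousLinearMap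
  have hcomp : L₀.comp R' = (ContinuousLinearEquiv.refl ℝ F : F →L[ℝ] F) := by
    ext x
    exact DFunLike.congr_fun hR x
  have hc : ContinuousAt (fun L : E →L[ℝ] F => L.comp R') L₀ := by fun_prop
  have hn := (ContinuousLinearEquiv.refl ℝ F).nhds
  rw [← hcomp] at hn
  filter_upwards [hc hn] with L ⟨e, he⟩ y
  refine ⟨R' (e.symm y), ?_⟩
  have := DFunLike.congr_fun he (e.symm y)
  simpa using this.symm

/-- An implicit function theorem with an arbitrary topological space of parameters. The unknown
ranges over a complete space, so that a contraction argument, uniform in the parameter, solves the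
equation; the parameters need not form a complete space. -/
theorem exists_continuousAt_implicit {X E F : Type*} [TopologicalSpace X]
    [NormedAddCommGroup E] [NormedSpace ℝ E] [CompleteSpace E]
    [NormedAddCommGroup F] [NormedSpace ℝ F]
    {f : X → E → F} {f' : X × E → E →L[ℝ] F} {x₀ : X} {e₀ : E} (A : E ≃L[ℝ] F)
    (hf : ∀ᶠ z in 𝓝 (x₀, e₀), HasFDerivAt (f z.1) (f' z) z.2)
    (hf' : Tendsto f' (𝓝 (x₀, e₀)) (𝓝 (A : E →L[ℝ] F)))
    (hc : ∀ᶠ z in 𝓝 (x₀, e₀), ContinuousAt (fun x => f x z.2) z.1) :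
    ∃ g : X → E, g x₀ = e₀ ∧ ∀ᶠ x in 𝓝 x₀, f x (g x) = f x₀ e₀ ∧ ContinuousAt g x := by
  -- the summand `1` keeps `N` positive when `E` is trivial
  set N : NNReal := ‖(A.symm : F →L[ℝ] E)‖₊ + 1 with hN
  have hN0 : 0 < N := by positivity
  have hNb : ∀ y, ‖A.symm y‖ ≤ N * ‖y‖ := fun y =>
    ((A.symm : F →L[ℝ] E).le_opNorm y).trans (by gcongr; simp [hN])
  set c : NNReal := N⁻¹ / 2 with hcdef
  have hc0 : 0 < c := by positivity
  have hNc : (N : ℝ) * c = 1 / 2 := by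
    have : (N : ℝ) ≠ 0 := by positivity
    rw [hcdef]; push_cast; field_simp
  have hnear : ∀ᶠ z in 𝓝 (x₀, e₀), ‖f' z - A‖ ≤ c := by
    have := hf'.eventually (closedBall_mem_nhds _ (ε := (c : ℝ)) (by exact_mod_cast hc0))
    filter_upwards [this] with z hz
    simpa [dist_eq_norm] using hz
  obtain ⟨O, hO, B, hB, hOB⟩ := mem_nhds_prod_iff.1 (hf.and (hnear.and hc))
  obtain ⟨ρ, hρ, hρB⟩ := nhds_basis_closedBall.mem_iff.1 hB
  have hin : ∀ x ∈ O, ∀ e ∈ closedBall e₀ ρ, HasFDerivAt (f x) (f' (x, e)) e ∧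
      ‖f' (x, e) - A‖ ≤ c ∧ ContinuousAt (fun x => f x e) x :=
    fun x hx e he => hOB (Set.mk_mem_prod hx (hρB he))
  have happrox : ∀ x ∈ O, ApproximatesLinearOn (f x) (A : E →L[ℝ] F) (closedBall e₀ ρ) c :=
    fun x hx e he e' he' => (convex_closedBall e₀ ρ).norm_image_sub_le_of_norm_hasFDerivWithin_le'
      (fun y hy => (hin x hx y hy).1.hasFDerivWithinAt) (fun y hy => (hin x hx y hy).2.1) he' he
  have hanti : ∀ x ∈ O, ∀ e ∈ closedBall e₀ ρ, ∀ e' ∈ closedBall e₀ ρ,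
      ‖e - e'‖ ≤ 2 * N * ‖f x e - f x e'‖ := by
    intro x hx e he e' he'
    have h1 := happrox x hx e he e' he'
    have h2 := hNb (A (e - e'))
    rw [A.symm_apply_apply] at h2
    have h3 : ‖A (e - e')‖ ≤ ‖f x e - f x e'‖ + c * ‖e - e'‖ := by
      calc ‖A (e - e')‖ = ‖(f x e - f x e') - (f x e - f x e' - (A : E →L[ℝ] F) (e - e'))‖ := by
            simp
        _ ≤ _ := (norm_sub_le _ _).trans (by gcongr)
    have h4 : (N : ℝ) * ‖A (e - e')‖ ≤ N * ‖f x e - f x e'‖ + 1 / 2 * ‖e - e'‖ := by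
      calc (N : ℝ) * ‖A (e - e')‖ ≤ N * (‖f x e - f x e'‖ + c * ‖e - e'‖) := by gcongr
        _ = N * ‖f x e - f x e'‖ + (N * c) * ‖e - e'‖ := by ring
        _ = _ := by rw [hNc]
    linarith
  let R : (A : E →L[ℝ] F).NonlinearRightInverse :=
    { toFun := A.symm, nnnorm := N, bound' := hNb, right_inv' := fun y => by simp }
  have he₀ : e₀ ∈ closedBall e₀ ρ := mem_closedBall_self hρ.le
  have hrad : 0 < ((N : ℝ)⁻¹ - c) * ρ := by
    have : (N : ℝ)⁻¹ - c = c := by rw [hcdef]; push_cast; ring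
    rw [this]; positivity
  have hex : ∀ᶠ x in 𝓝 x₀, ∃ e ∈ closedBall e₀ ρ, f x e = f x₀ e₀ := by
    have hcont := (hin x₀ (mem_of_mem_nhds hO) e₀ he₀).2.2
    filter_upwards [hO, hcont (closedBall_mem_nhds _ hrad)] with x hx hx'
    have := (happrox x hx).surjOn_closedBall_of_nonlinearRightInverse R hρ.le subset_rfl
    exact this (mem_closedBall_comm.1 hx')
  classical
  let g : X → E := fun x =>
    if h : ∃ e ∈ closedBall e₀ ρ, f x e = f x₀ e₀ then h.choose else e₀
  have hg : ∀ x, (∃ e ∈ closedBall e₀ ρ, f x e = f x₀ e₀) →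
      g x ∈ closedBall e₀ ρ ∧ f x (g x) = f x₀ e₀ := fun x h => by
    simpa only [g, dif_pos h] using h.choose_spec
  refine ⟨g, ?_, ?_⟩
  · have h := hg x₀ ⟨e₀, he₀, rfl⟩
    have := hanti x₀ (mem_of_mem_nhds hO) _ h.1 _ he₀
    rw [h.2, sub_self, norm_zero, mul_zero] at this
    exact sub_eq_zero.1 (norm_le_zero_iff.1 this)
  · filter_upwards [hex.eventually_nhds, eventually_eventually_nhds.2 hO] with x hx hxO
    obtain ⟨hgx, hfx⟩ := hg x hx.self_of_nhds
    refine ⟨hfx, tendsto_iff_norm_sub_tendsto_zero.2 ?_⟩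
    have hcx := (hin x hxO.self_of_nhds _ hgx).2.2
    have hlim : Tendsto (fun x' => 2 * (N : ℝ) * ‖f x (g x) - f x' (g x)‖) (𝓝 x) (𝓝 0) := by
      have := ((tendsto_const_nhds (x := f x (g x))).sub hcx).norm.const_mul (2 * (N : ℝ))
      simpa using this
    refine squeeze_zero' (Eventually.of_forall fun _ => norm_nonneg _) ?_ hlim
    filter_upwards [hx, hxO] with x' hx' hxO'
    obtain ⟨h1, h2⟩ := hg x' hx'
    have := hanti x' hxO' _ h1 _ hgx
    rwa [h2, ← hfx] at this

/-! ### Symmetry of the equivalence of marked fields -/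

lemma endsAlong_comp_iff {x : ℝ → S2} {l : Filter ℝ} {p : S2} {e : E3} (τ : ℝ ≃o ℝ)
    (hτ : map τ l = l) : EndsAlong (x ∘ τ) l p e ↔ EndsAlong x l p e := by
  have key : ∀ {Y : Type} (f : ℝ → Y) (n : Filter Y), Tendsto (f ∘ τ) l n ↔ Tendsto f l n := by
    intro Y f n
    rw [← tendsto_map'_iff, hτ]
  exact and_congr (key _ _) (key (fun t => ‖(x t : E3) - p‖⁻¹ • ((x t : E3) - p)) _)

lemma OrientationPreserving.symm {H : S2 ≃ₜ S2} (h : OrientationPreserving H) :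
    OrientationPreserving H.symm := by
  unfold OrientationPreserving at h ⊢
  set Φ := (AlgebraicTopology.singularHomologyFunctor (ModuleCat.{0} ℤ) 2).obj (ModuleCat.of ℤ ℤ)
  have h1 : CategoryTheory.CategoryStruct.comp (Φ.map (TopCat.ofHom (H : C(S2, S2))))
      (Φ.map (TopCat.ofHom (H.symm : C(S2, S2)))) = CategoryTheory.CategoryStruct.id _ := by
    rw [← Φ.map_comp, ← TopCat.ofHom_comp]
    have : (H.symm : C(S2, S2)).comp (H : C(S2, S2)) = ContinuousMap.id S2 := by
      ext1 x
      simp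
    rw [this, TopCat.ofHom_id, Φ.map_id]
  rwa [h, CategoryTheory.Category.id_comp] at h1

/-- A trajectory of `w` is only mapped by `H⁻¹` to a reparametrized trajectory of `v`; the ends of a
curve do not depend on the parametrization. -/
lemma SepEquivalent.symm {N : ℕ} {v w : MarkedField N} (h : SepEquivalent v w) :
    SepEquivalent w v := by
  obtain ⟨H, hor, hvw, hwv, hs, hsep⟩ := h
  refine ⟨H.symm, hor.symm, hwv, by simpa using hvw, fun i => by simp [← hs i], ?_⟩
  intro i j x hx
  obtain ⟨τ, hτ⟩ := hwv x hx
  have hx' : H ∘ (H.symm ∘ x ∘ τ) = x ∘ τ := by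
    ext1 t
    simp
  obtain ⟨h1, h2⟩ := hsep i j _ hτ
  rw [hx'] at h1 h2
  have assoc : H.symm ∘ x ∘ τ = (H.symm ∘ x) ∘ τ := rfl
  rw [assoc] at h1 h2
  rw [endsAlong_comp_iff τ τ.map_atTop, endsAlong_comp_iff τ τ.map_atTop] at h1
  rw [endsAlong_comp_iff τ τ.map_atBot, endsAlong_comp_iff τ τ.map_atBot] at h2
  exact ⟨h1.symm, h2.symm⟩

/-! ### Transverse families -/

section TransverseFamilies

variable {N m k : ℕ} {M : Set (MarkedField N)} {V V' : Rn k → MarkedField N}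

lemma continuous_field : Continuous (MarkedField.field (N := N)) :=
  continuous_fst.comp
    (continuous_induced_dom (f := fun v : MarkedField N => (v.field, v.saddle, v.dir)))

lemma IsLocalFamily.continuousAt (h : IsLocalFamily V) : ContinuousAt V 0 :=
  h.1.self_of_nhds

lemma IsLocalFamily.translate (h : IsLocalFamily V) :
    ∀ᶠ β in 𝓝 (0 : Rn k), IsLocalFamily (fun α => V (β + α)) := by
  filter_upwards [h.1.eventually_nhds, h.2.eventually_nhds] with β h1 h2
  have hβ : Tendsto (fun α : Rn k => β + α) (𝓝 0) (𝓝 β) := by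
    have : Continuous (fun α : Rn k => β + α) := by fun_prop
    simpa using this.tendsto 0
  refine ⟨?_, ?_⟩
  · filter_upwards [hβ.eventually h1] with α hα
    exact ContinuousAt.comp (f := fun α : Rn k => β + α) hα (by fun_prop)
  · filter_upwards [hβ.eventually h2] with α hα x
    have hs : ContMDiffAt (𝓘(ℝ, Rn k).prod (𝓡 2)) (𝓘(ℝ, Rn k).prod (𝓡 2)) 3
        (fun p : Rn k × S2 => (β + p.1, p.2)) (α, x) :=
      (((contDiff_const.add contDiff_id).contMDiff (n := 3)).comp contMDiff_fst).contMDiffAt.prodMk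
        contMDiff_snd.contMDiffAt
    exact ContMDiffAt.comp (α, x) (hα x) hs

/-- In terms of a defining map `F` of `M`, transversality says that the differential of `F` along
the family is onto. -/
lemma IsTransverse.exists_surjective_fderiv (h : IsTransverse M m V) :
    ∃ F : Vect → Rn m, IsDefiningMap M m (V 0) F ∧
      ContDiffAt ℝ 1 (fun α => F (V α).field) 0 ∧
      Function.Surjective (fderiv ℝ (fun α => F (V α).field) 0) := by
  obtain ⟨-, hV, F, hF, hsp⟩ := h
  refine ⟨F, hF, hF.1.comp (0 : Rn k) hV, fun y => ?_⟩
  obtain ⟨w, rfl⟩ := hF.2.1 y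
  obtain ⟨a, u, hu, rfl⟩ := hsp w
  refine ⟨a, ?_⟩
  have := fderiv_comp (0 : Rn k) (hF.1.differentiableAt one_ne_zero)
    (hV.differentiableAt one_ne_zero)
  have h2 := DFunLike.congr_fun this a
  simp only [Function.comp_def] at h2
  rw [h2, map_add, hu, add_zero]
  rfl

lemma isTransverse_of_surjective_fderiv {F : Vect → Rn m} (h0 : V 0 ∈ M)
    (hV : ContDiffAt ℝ 1 (fun α => (V α).field) 0) (hF : IsDefiningMap M m (V 0) F)
    (hs : Function.Surjective (fderiv ℝ (fun α => F (V α).field) 0)) : IsTransverse M m V := by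
  refine ⟨h0, hV, F, hF, fun w => ?_⟩
  obtain ⟨a, ha⟩ := hs (fderiv ℝ F (V 0).field w)
  refine ⟨a, w - fderiv ℝ (fun α => (V α).field) 0 a, ?_, by abel⟩
  have := fderiv_comp (0 : Rn k) (hF.1.differentiableAt one_ne_zero)
    (hV.differentiableAt one_ne_zero)
  have h2 := DFunLike.congr_fun this a
  simp only [Function.comp_def] at h2
  rw [h2] at ha
  rw [map_sub, sub_eq_zero]
  exact ha.symm

lemma IsDefiningMap.eventually {v : MarkedField N} {F : Vect → Rn m} (h : IsDefiningMap M m v F) :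
    ∀ᶠ w in 𝓝 v, IsDefiningMap M m w F := by
  have h1 := h.1.eventually (by simp)
  have h2 : ∀ᶠ u in 𝓝 v.field, Function.Surjective (fderiv ℝ F u) :=
    ((h.1.fderiv_right (m := 0) (by simp)).continuousAt.tendsto).eventually
      (eventually_surjective h.2.1)
  filter_upwards [continuous_field.continuousAt.eventually h1,
    continuous_field.continuousAt.eventually h2, h.2.2.eventually_nhds] with w h1 h2 h3
  exact ⟨h1, h2, h3⟩

/-- Transversality is an open condition along a family: near the base point, a family can be
re-based at any of its members that belong to `M`. -/
lemma eventually_translate_mem_transverseFamilies (h : V ∈ transverseFamilies M m k) :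
    ∀ᶠ β in 𝓝 (0 : Rn k), V β ∈ M → (fun α => V (β + α)) ∈ transverseFamilies M m k := by
  obtain ⟨hfam, htr⟩ := h
  obtain ⟨F, hF, hFV, hs⟩ := htr.exists_surjective_fderiv
  have h2 : ∀ᶠ β in 𝓝 (0 : Rn k), Function.Surjective (fderiv ℝ (fun α => F (V α).field) β) :=
    ((hFV.fderiv_right (m := 0) (by simp)).continuousAt.tendsto).eventually
      (eventually_surjective hs)
  filter_upwards [hfam.translate, htr.2.1.eventually (by simp), h2,
    hfam.continuousAt.eventually hF.eventually] with β h1 h3 h2 h4 hβ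
  refine ⟨h1, isTransverse_of_surjective_fderiv (F := F) (by simpa using hβ) ?_ (by simpa using h4)
    ?_⟩
  · have h3' : ContDiffAt ℝ 1 (fun α => (V α).field) (β + 0) := by simpa using h3
    exact h3'.comp (0 : Rn k) (f := fun α => β + α) (by fun_prop)
  · rw [fderiv_comp_add_left (f := fun α => F (V α).field), add_zero]
    exact h2

/-! ### The invariant germ of a transverse family -/

lemma isSubmanifoldGerm_preimage {d : ℕ} {V : Rn (d + m) → MarkedField N}
    (h : V ∈ transverseFamilies M m (d + m)) : IsSubmanifoldGerm 1 d (V ⁻¹' M) := by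
  obtain ⟨F, hF, hFV, hs⟩ := h.2.exists_surjective_fderiv
  exact ⟨h.2.1, m, rfl, fun α => F (V α).field, hFV, hs, h.1.continuousAt.eventually hF.2.2⟩

lemma isSmoothGermOn_preimage {D : ℕ} {f : MarkedField N → Rn D} {G : Vect → Rn D}
    (h : V ∈ transverseFamilies M m k) (hG : ContDiffAt ℝ 1 G (V 0).field)
    (hfG : ∀ᶠ w in 𝓝 (V 0), w ∈ M → f w = G w.field) :
    IsSmoothGermOn 1 (V ⁻¹' M) (fun α => f (V α)) :=
  ⟨fun α => G (V α).field, hG.comp (0 : Rn k) h.2.2.1,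
    eventually_nhdsWithin_iff.2 (h.1.continuousAt.eventually hfG)⟩

/-- A local homeomorphism of the parameter space that matches the domains and the functions of two
germs near `0` restricts to an equivalence of the germs. -/
lemma germEquivalent_of_openPartialHomeomorph {D : ℕ} {S S' : Set (Rn k)} {f f' : Rn k → Rn D}
    (h : OpenPartialHomeomorph (Rn k) (Rn k)) (h0 : (0 : Rn k) ∈ h.source) (hh0 : h 0 = 0)
    (hS : ∀ᶠ α in 𝓝 (0 : Rn k), α ∈ S ↔ h α ∈ S')
    (hf : ∀ᶠ α in 𝓝 (0 : Rn k), α ∈ S → f' (h α) = f α) : GermEquivalent S f S' f' := by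
  obtain ⟨O, hO, hOo, h0O⟩ := _root_.eventually_nhds_iff.1 (hS.and hf)
  let h' := h.restrOpen O hOo
  have hsrc : h'.source = h.source ∩ O := h.restrOpen_source O hOo
  have h0' : (0 : Rn k) ∈ h'.source := by rw [hsrc]; exact ⟨h0, h0O⟩
  have hcoe : ∀ α, h' α = h α := fun α => rfl
  have htgt : ∀ β ∈ h'.target, h'.symm β ∈ S ↔ β ∈ S' := by
    intro β hβ
    have h1 := h'.map_target hβ
    have h2 := h'.right_inv hβ
    rw [hsrc] at h1
    rw [(hO _ h1.2).1, ← hcoe, h2]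
  have h0t : (0 : Rn k) ∈ h'.target := by
    have := h'.map_source h0'
    rwa [hcoe, hh0] at this
  refine ⟨h'.toPartialEquiv.restr S, ?_, ?_, ?_, ?_, ?_, ?_, hh0, ?_⟩
  · rw [PartialEquiv.restr_source]
    exact Set.inter_subset_right
  · rw [PartialEquiv.restr_source]
    exact inter_mem (mem_nhdsWithin_of_mem_nhds (h'.open_source.mem_nhds h0')) self_mem_nhdsWithin
  · rw [PartialEquiv.restr_target]
    exact fun β hβ => (htgt β hβ.1).1 hβ.2
  · rw [PartialEquiv.restr_target]
    filter_upwards [mem_nhdsWithin_of_mem_nhds (h'.open_target.mem_nhds h0t),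
      self_mem_nhdsWithin] with β h1 h2
    exact ⟨h1, (htgt β h1).2 h2⟩
  · rw [PartialEquiv.restr_source]
    exact h'.continuousOn.mono Set.inter_subset_left
  · rw [PartialEquiv.restr_target]
    exact h'.continuousOn_symm.mono Set.inter_subset_left
  · intro α hα
    rw [PartialEquiv.restr_source] at hα
    have : α ∈ h'.source := hα.1
    rw [hsrc] at this
    exact (hO α this.2).2 hα.2

/-- Re-basing the equivalence `h` of two families at a nearby parameter `β`. -/
lemma familiesEquivalent_translate (h : OpenPartialHomeomorph (Rn k) (Rn k))
    (hV : ∀ᶠ α in 𝓝 (0 : Rn k), SepEquivalent (V α) (V' (h α))) :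
    ∀ᶠ β in 𝓝 (0 : Rn k), β ∈ h.source →
      FamiliesEquivalent (fun α => V (β + α)) (fun α => V' (h β + α)) := by
  filter_upwards [hV.eventually_nhds] with β hβ hs
  let H := ((Homeomorph.addLeft β).toOpenPartialHomeomorph.trans h).trans
    (Homeomorph.addLeft (-h β)).toOpenPartialHomeomorph
  have hH : ∀ α, H α = -h β + h (β + α) := fun α => rfl
  refine ⟨H, by simpa [H] using hs, by simp [hH], ?_⟩
  have hc : Tendsto (fun α : Rn k => β + α) (𝓝 0) (𝓝 β) := by
    have : Continuous (fun α : Rn k => β + α) := by fun_prop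
    simpa using this.tendsto 0
  filter_upwards [hc.eventually hβ] with α hα
  simpa [hH] using hα

/-- The equivalence of the families restricts to an equivalence of the invariant germs: the domains
correspond because `M` is topologically distinguished, and the values because `φ` is robustly
invariant along the families re-based at the points of the domain. -/
lemma germEquivalent_of_familiesEquivalent {D : ℕ} {φ : Fin D → MarkedField N → ℝ} (hmk : m ≤ k)
    (hMtop : TopologicallyDistinguished M) (hφ : ∀ j, RobustlyInvariant M m (φ j))
    (hV : V ∈ transverseFamilies M m k) (hV' : V' ∈ transverseFamilies M m k)
    (hVV' : FamiliesEquivalent V V') :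
    GermEquivalent (V ⁻¹' M) (fun α => vectorOf φ (V α))
      (V' ⁻¹' M) (fun α => vectorOf φ (V' α)) := by
  obtain ⟨h, h0, hh0, heq⟩ := hVV'
  obtain ⟨𝒰, hUo, hMU, hU⟩ := hMtop
  have hc : Tendsto h (𝓝 0) (𝓝 0) := by simpa [ContinuousAt, hh0] using h.continuousAt h0
  have hiff : ∀ᶠ α in 𝓝 (0 : Rn k), V α ∈ M ↔ V' (h α) ∈ M := by
    filter_upwards [heq, hV.1.continuousAt (hUo.mem_nhds (hMU hV.2.1)),
      hc.eventually (hV'.1.continuousAt (hUo.mem_nhds (hMU hV'.2.1)))] with α h1 h2 h3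
    refine ⟨fun hM => ?_, fun hM => ?_⟩
    · by_contra hn
      exact hU _ hM _ ⟨h3, hn⟩ h1
    · by_contra hn
      exact hU _ hM _ ⟨h2, hn⟩ h1.symm
  refine germEquivalent_of_openPartialHomeomorph h h0 hh0 hiff ?_
  filter_upwards [hiff, eventually_translate_mem_transverseFamilies hV,
    hc.eventually (eventually_translate_mem_transverseFamilies hV'),
    familiesEquivalent_translate h heq, h.open_source.mem_nhds h0] with β h1 h2 h3 h4 h5 hβ
  have hval : ∀ j, φ j (V β) = φ j (V' (h β)) := fun j => by
    simpa using hφ j k hmk _ (h2 hβ) _ (h3 (h1.1 hβ)) (h4 h5)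
  simp [vectorOf, hval]

end TransverseFamilies

/-! ### Joint continuity of the one-jet of a vector field -/

lemma norm_jet_apply_le (v : Vect) (i : Fin 4) (x : S2) : ‖iteratedFDeriv ℝ i v.ext x‖ ≤ ‖v‖ :=
  ((Vect.jet v i).norm_coe_le_norm x).trans (norm_le_pi_norm (Vect.jet v) i)

lemma norm_ext_le (v : Vect) (y : E3) : ‖v.ext y‖ ≤ ‖v‖ := by
  have h := norm_jet_apply_le v 0 (radial y)
  rw [Fin.val_zero, norm_iteratedFDeriv_zero, Vect.ext_coe] at h
  exact h

lemma norm_fderiv_ext_coe_le (v : Vect) (x : S2) : ‖fderiv ℝ v.ext x‖ ≤ ‖v‖ := by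
  have h := norm_jet_apply_le v 1 x
  rwa [Fin.val_one, norm_iteratedFDeriv_one] at h

lemma coe_radial {y : E3} (hy : y ≠ 0) : (radial y : E3) = ‖y‖⁻¹ • y := by
  simp [radial, hy]

lemma radial_smul {t : ℝ} (ht : 0 < t) (y : E3) : radial (t • y) = radial y := by
  by_cases hy : y = 0
  · simp [hy]
  · apply Subtype.ext
    rw [coe_radial hy, coe_radial (smul_ne_zero ht.ne' hy), norm_smul, smul_smul,
      Real.norm_of_nonneg ht.le]
    congr 1
    field_simp

lemma ext_smul {t : ℝ} (ht : 0 < t) (v : Vect) (y : E3) : v.ext (t • y) = v.ext y := by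
  simp [Vect.ext, radial_smul ht]

lemma differentiableAt_ext (v : Vect) {y : E3} (hy : y ≠ 0) : DifferentiableAt ℝ v.ext y :=
  (v.contDiffAt_ext hy).differentiableAt (by simp)

/-- The derivative of the ray-constant extension is homogeneous of degree `-1`, so the `C³` norm,
which only sees points of the sphere, controls it on `E3 \ {0}`. -/
lemma fderiv_ext_eq (v : Vect) {y : E3} (hy : y ≠ 0) :
    fderiv ℝ v.ext y = ‖y‖⁻¹ • fderiv ℝ v.ext (radial y) := by
  have ht : 0 < ‖y‖⁻¹ := inv_pos.2 (norm_pos_iff.2 hy)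
  have h : v.ext = fun z => v.ext (‖y‖⁻¹ • z) := funext fun z => (ext_smul ht v z).symm
  conv_lhs => rw [h]
  rw [fderiv_comp_smul, coe_radial hy]

lemma norm_fderiv_ext_le (v : Vect) {y : E3} (hy : y ≠ 0) : ‖fderiv ℝ v.ext y‖ ≤ ‖y‖⁻¹ * ‖v‖ := by
  rw [fderiv_ext_eq v hy, norm_smul, norm_inv, norm_norm]
  gcongr
  exact norm_fderiv_ext_coe_le v _

lemma ext_sub_apply (v w : Vect) (y : E3) : (v - w).ext y = v.ext y - w.ext y := rfl

lemma continuousAt_ext_uncurry (v : Vect) {y : E3} (hy : y ≠ 0) :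
    ContinuousAt (fun z : Vect × E3 => z.1.ext z.2) (v, y) := by
  have h1 : ContinuousAt (fun z : Vect × E3 => v.ext z.2) (v, y) :=
    ContinuousAt.comp (f := Prod.snd) (g := v.ext) (differentiableAt_ext v hy).continuousAt
      continuousAt_snd
  have h2 : Tendsto (fun z : Vect × E3 => (z.1 - v).ext z.2) (𝓝 (v, y)) (𝓝 0) := by
    refine squeeze_zero_norm (fun z => norm_ext_le _ _) ?_
    have : Continuous (fun z : Vect × E3 => ‖z.1 - v‖) := by fun_prop
    simpa using this.tendsto (v, y)
  have h3 := h2.add h1.tendsto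
  simp only [zero_add] at h3
  refine h3.congr fun z => ?_
  rw [ext_sub_apply, sub_add_cancel]

lemma continuousAt_fderiv_ext_uncurry (v : Vect) {y : E3} (hy : y ≠ 0) :
    ContinuousAt (fun z : Vect × E3 => fderiv ℝ z.1.ext z.2) (v, y) := by
  have h1 : ContinuousAt (fun z : Vect × E3 => fderiv ℝ v.ext z.2) (v, y) :=
    ContinuousAt.comp (f := Prod.snd) (g := fderiv ℝ v.ext)
      ((v.contDiffAt_ext hy).fderiv_right (m := 2) (by norm_num)).continuousAt continuousAt_snd
  have hne : ∀ᶠ z : Vect × E3 in 𝓝 (v, y), z.2 ≠ 0 := continuousAt_snd.eventually_ne hy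
  have h2 : Tendsto (fun z : Vect × E3 => fderiv ℝ (z.1 - v).ext z.2) (𝓝 (v, y)) (𝓝 0) := by
    refine squeeze_zero_norm' (hne.mono fun z hz => norm_fderiv_ext_le _ hz) ?_
    have : ContinuousAt (fun z : Vect × E3 => ‖z.2‖⁻¹ * ‖z.1 - v‖) (v, y) :=
      (continuousAt_snd.norm.inv₀ (by simpa using hy)).mul (by fun_prop)
    simpa [ContinuousAt] using this
  have h3 := h2.add h1.tendsto
  simp only [zero_add] at h3
  refine h3.congr' (hne.mono fun z hz => ?_)
  have h4 : (z.1 - v).ext = z.1.ext - v.ext := rfl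
  rw [h4, fderiv_sub (differentiableAt_ext _ hz) (differentiableAt_ext _ hz), sub_add_cancel]

/-! ### The linearization at a hyperbolic saddle -/

lemma inner_eval_coe (v : Vect) (x : S2) : inner ℝ (v x) (x : E3) = 0 :=
  (Subtype.property (p := fun f => f ∈ fieldSubmodule) v).2 x

lemma inner_ext_self (v : Vect) (y : E3) : inner ℝ (v.ext y) y = 0 := by
  by_cases hy : y = 0
  · simp [hy]
  · have h := inner_eval_coe v (radial y)
    rw [coe_radial hy, inner_smul_right] at h
    exact (mul_eq_zero.1 h).resolve_left (inv_ne_zero (norm_ne_zero_iff.2 hy))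

lemma linearization_coe (v : Vect) (p : S2) : v.linearization p p = 0 := by
  have h1 : HasDerivAt (fun t : ℝ => t • (p : E3)) (p : E3) 1 := by
    simpa using (hasDerivAt_id (1 : ℝ)).smul_const (p : E3)
  have h2 : HasFDerivAt v.ext (fderiv ℝ v.ext p) ((1 : ℝ) • (p : E3)) := by
    rw [one_smul]
    exact (differentiableAt_ext v (coe_ne_zero p)).hasFDerivAt
  have h3 := h2.comp_hasDerivAt (1 : ℝ) h1
  -- `v.ext` is constant along the ray through `p`
  have h4 : v.ext ∘ (fun t : ℝ => t • (p : E3)) =ᶠ[𝓝 1] fun _ => v.ext p := by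
    filter_upwards [lt_mem_nhds (zero_lt_one (α := ℝ))] with t ht
    exact ext_smul ht v p
  exact h3.unique ((hasDerivAt_const (1 : ℝ) (v.ext p)).congr_of_eventuallyEq h4)

/-- The linearization at a zero takes values in the tangent plane: differentiate
`⟪v y, y⟫ = 0`. -/
lemma inner_linearization_coe {v : Vect} {p : S2} (hp : v p = 0) (h : E3) :
    inner ℝ (v.linearization p h) (p : E3) = 0 := by
  have h1 := ((differentiableAt_ext v (coe_ne_zero p)).hasFDerivAt).inner ℝ
    (hasFDerivAt_id (p : E3))
  have h2 : (fun y => inner ℝ (v.ext y) (id y)) = fun _ => (0 : ℝ) :=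
    funext fun y => inner_ext_self v y
  rw [h2] at h1
  have h3 := DFunLike.congr_fun (h1.unique (hasFDerivAt_const (0 : ℝ) (p : E3))) h
  simpa [fderivInnerCLM_apply, Vect.ext_coe, hp, Vect.linearization] using h3

/-- At a hyperbolic saddle `p` the differential of the ray-constant extension has three distinct
real eigenvalues: those of the linearization on the tangent plane, and `0` along the ray. -/
lemma IsHyperbolicSaddle.exists_eigenbasis {v : Vect} {p : S2} (h : IsHyperbolicSaddle v p) :
    ∃ (bs : Module.Basis (Fin 3) ℝ E3) (μ : Fin 3 → ℝ), Function.Injective μ ∧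
      ∀ i, v.linearization p (bs i) = μ i • bs i := by
  obtain ⟨-, a, b, lam, mu, ha, hb, -, -, hLa, hLb, hl, hm⟩ := h
  have hinj : Function.Injective ![lam, mu, 0] := by
    intro i j hij
    fin_cases i <;> fin_cases j <;> simp at hij ⊢ <;> linarith
  have hev : ∀ i, v.linearization p (![a, b, (p : E3)] i) = ![lam, mu, 0] i • ![a, b, (p : E3)] i := by
    intro i
    fin_cases i
    · simpa using hLa
    · simpa using hLb
    · simpa using linearization_coe v p
  have hne : ∀ i, ![a, b, (p : E3)] i ≠ 0 := by
    intro i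
    fin_cases i
    · simpa using ha
    · simpa using hb
    · simpa using coe_ne_zero p
  have hli : LinearIndependent ℝ ![a, b, (p : E3)] :=
    Module.End.eigenvectors_linearIndependent' (v.linearization p : E3 →ₗ[ℝ] E3) ![lam, mu, 0] hinj _
      fun i => ⟨Module.End.mem_eigenspace_iff.2 (hev i), hne i⟩
  refine ⟨basisOfLinearIndependentOfCardEqFinrank hli (by simp), ![lam, mu, 0], hinj,
    fun i => ?_⟩
  simpa using hev i

section Diagonal

variable {ι : Type*} [Fintype ι] {bs : Module.Basis ι ℝ E3} {μ : ι → ℝ} {Λ : E3 →L[ℝ] E3}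

lemma repr_apply_of_eigenbasis (hΛ : ∀ i, Λ (bs i) = μ i • bs i) (h : E3) (i : ι) :
    bs.repr (Λ h) i = μ i * bs.repr h i := by
  classical
  have h1 : Λ h = ∑ j, (μ j * bs.repr h j) • bs j := by
    conv_lhs => rw [← bs.sum_repr h]
    rw [map_sum]
    exact Finset.sum_congr rfl fun j _ => by rw [map_smul, hΛ, smul_smul, mul_comm]
  rw [h1, bs.repr_sum_self]

/-- An eigenvalue of a map with simple spectrum is a simple zero of the eigenvector equations
`Λ e = ν e`, `‖e‖² = 1`: the linearized equations have only the trivial solution. -/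
lemma eigenvector_equation_linearized (hμ : Function.Injective μ)
    (hΛ : ∀ i, Λ (bs i) = μ i • bs i) {e h : E3} {ν s : ℝ} (he : e ≠ 0) (hev : Λ e = ν • e)
    (h1 : Λ h - ν • h - s • e = 0) (h2 : inner ℝ e h = 0) : h = 0 ∧ s = 0 := by
  have c1 : ∀ j, (μ j - ν) * bs.repr h j = s * bs.repr e j := by
    intro j
    have := congrArg (fun z => bs.repr z j) h1
    simp only [map_sub, map_smul, Finsupp.sub_apply, Finsupp.smul_apply, smul_eq_mul,
      repr_apply_of_eigenbasis hΛ, map_zero, Finsupp.zero_apply] at this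
    linarith
  have c2 : ∀ j, (μ j - ν) * bs.repr e j = 0 := by
    intro j
    have := congrArg (fun z => bs.repr z j) hev
    simp only [map_smul, Finsupp.smul_apply, smul_eq_mul, repr_apply_of_eigenbasis hΛ] at this
    linarith
  obtain ⟨i, hi⟩ : ∃ i, bs.repr e i ≠ 0 := by
    by_contra! hall
    exact he (bs.ext_elem fun i => by simpa using hall i)
  have hν : μ i = ν := by
    have := (mul_eq_zero.1 (c2 i)).resolve_right hi
    linarith
  have hs : s = 0 := by
    have := c1 i
    rw [hν, sub_self, zero_mul] at this
    exact (mul_eq_zero.1 this.symm).resolve_right hi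
  have hne : ∀ j, j ≠ i → μ j - ν ≠ 0 := fun j hj h0 =>
    hj (hμ (by rw [hν]; linarith))
  have hprop : h = (bs.repr h i / bs.repr e i) • e := by
    refine bs.ext_elem fun j => ?_
    rw [map_smul, Finsupp.smul_apply, smul_eq_mul]
    by_cases hj : j = i
    · subst hj
      field_simp
    · have e1 := (mul_eq_zero.1 (c2 j)).resolve_left (hne j hj)
      have e2 := c1 j
      rw [hs, zero_mul] at e2
      rw [e1, (mul_eq_zero.1 e2).resolve_left (hne j hj), mul_zero]
  refine ⟨?_, hs⟩
  rw [hprop, inner_smul_right, real_inner_self_eq_norm_sq] at h2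
  have h3 := (mul_eq_zero.1 h2).resolve_right (by simpa using he)
  rw [hprop, h3, zero_smul]

end Diagonal

lemma exists_continuousLinearEquiv_of_injective {E F : Type*} [NormedAddCommGroup E]
    [NormedSpace ℝ E] [FiniteDimensional ℝ E] [NormedAddCommGroup F] [NormedSpace ℝ F]
    [FiniteDimensional ℝ F] (hd : Module.finrank ℝ E = Module.finrank ℝ F) (L : E →L[ℝ] F)
    (hL : ∀ h, L h = 0 → h = 0) : ∃ A : E ≃L[ℝ] F, (A : E →L[ℝ] F) = L := by
  have hinj : Function.Injective (L : E →ₗ[ℝ] F) := (injective_iff_map_eq_zero _).2 hL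
  exact ⟨(LinearMap.linearEquivOfInjective (L : E →ₗ[ℝ] F) hinj hd).toContinuousLinearEquiv, by
    ext x; simp⟩

/-! ### Persistence of saddles and separatrices -/

/-- A zero of `v` on the sphere is the same as a nonzero solution `y` of
`v.ext y + (‖y‖² - 1) y = 0`, because `v.ext y` is orthogonal to `y`. This equation on the vector
space `E3` is nondegenerate at a saddle. -/
lemma IsHyperbolicSaddle.exists_continuation {v₀ : Vect} {p₀ : S2}
    (h : IsHyperbolicSaddle v₀ p₀) :
    ∃ q : Vect → S2, q v₀ = p₀ ∧ ∀ᶠ v in 𝓝 v₀, v (q v) = 0 ∧ ContinuousAt q v := by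
  let κ : E3 → E3 := fun y => (‖y‖ ^ 2 - 1) • y
  have hκ : ContDiff ℝ 2 κ := ((contDiff_norm_sq ℝ).sub contDiff_const).smul contDiff_id
  have hκ' : ∀ y z, fderiv ℝ κ y z = (‖y‖ ^ 2 - 1) • z + (2 * inner ℝ y z) • y := by
    intro y z
    have h1 := ((hasStrictFDerivAt_norm_sq y).hasFDerivAt.sub_const 1).smul (hasFDerivAt_id y)
    have h2 : HasFDerivAt κ _ y := h1
    rw [h2.fderiv]
    simp
  have hp1 : ‖(p₀ : E3)‖ = 1 := by simp
  obtain ⟨bs, μ, hμ, hΛ⟩ := h.exists_eigenbasis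
  obtain ⟨A, hA⟩ := exists_continuousLinearEquiv_of_injective rfl
    (fderiv ℝ v₀.ext p₀ + fderiv ℝ κ p₀) (fun z hz => by
      have hz1 : v₀.linearization p₀ z + (2 * inner ℝ (p₀ : E3) z) • (p₀ : E3) = 0 := by
        have := hz
        rw [_root_.add_apply, hκ', hp1] at this
        simpa [Vect.linearization] using this
      have hz2 : inner ℝ (p₀ : E3) z = 0 := by
        have := congrArg (fun y => inner ℝ y (p₀ : E3)) hz1
        simpa [inner_add_left, inner_smul_left, inner_linearization_coe h.1] using this
      rw [hz2, mul_zero, zero_smul, add_zero] at hz1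
      have := eigenvector_equation_linearized (s := 0) (ν := 0) hμ hΛ (coe_ne_zero p₀)
        (by simpa using linearization_coe v₀ p₀) (by simpa using hz1) hz2
      exact this.1)
  have hne : ∀ᶠ z : Vect × E3 in 𝓝 (v₀, (p₀ : E3)), z.2 ≠ 0 :=
    continuousAt_snd.eventually_ne (coe_ne_zero p₀)
  obtain ⟨g, hg0, hg⟩ := exists_continuousAt_implicit (f := fun v y => v.ext y + κ y)
    (f' := fun z => fderiv ℝ z.1.ext z.2 + fderiv ℝ κ z.2) (x₀ := v₀) (e₀ := (p₀ : E3)) A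
    (hne.mono fun z hz => (differentiableAt_ext _ hz).hasFDerivAt.add
      (hκ.differentiable (by simp) _).hasFDerivAt)
    (by
      rw [hA]
      exact (continuousAt_fderiv_ext_uncurry v₀ (coe_ne_zero p₀)).add
        (ContinuousAt.comp (f := Prod.snd) (g := fderiv ℝ κ)
          (hκ.continuous_fderiv (by simp)).continuousAt continuousAt_snd))
    (hne.mono fun z hz => (ContinuousAt.comp (f := fun v : Vect => (v, z.2))
      (continuousAt_ext_uncurry z.1 hz) (by fun_prop)).add continuousAt_const)
  have hgc : ContinuousAt g v₀ := hg.self_of_nhds.2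
  refine ⟨fun v => radial (g v), by simp only [hg0, radial_coe], ?_⟩
  have hgne : ∀ᶠ v in 𝓝 v₀, g v ≠ 0 := hgc.eventually_ne (by rw [hg0]; exact coe_ne_zero p₀)
  filter_upwards [hg, hgne] with v hv hvne
  refine ⟨?_, ContinuousAt.comp (g := radial) (contMDiffAt_radial hvne).continuousAt hv.2⟩
  have h1 : v.ext (g v) + (‖g v‖ ^ 2 - 1) • g v = 0 := by
    rw [show v.ext (g v) + (‖g v‖ ^ 2 - 1) • g v = v₀.ext p₀ + κ p₀ from hv.1, Vect.ext_coe, h.1]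
    simp [κ]
  have h2 := congrArg (fun y => inner ℝ y (g v)) h1
  simp only [inner_add_left, inner_ext_self, inner_smul_left, zero_add, inner_zero_left,
    real_inner_self_eq_norm_sq] at h2
  have h3 := (mul_eq_zero.1 h2).resolve_right (by simpa using hvne)
  have h4 : (‖g v‖ ^ 2 - 1) = 0 := by simpa using h3
  rw [h4, zero_smul, add_zero] at h1
  exact h1

/-- Continuation of a unit eigenvector with simple real eigenvalue. -/
lemma exists_eigenvector_continuation {ι : Type*} [Fintype ι] {bs : Module.Basis ι ℝ E3}
    {μ : ι → ℝ} {Λ₀ : E3 →L[ℝ] E3} (hμ : Function.Injective μ)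
    (hΛ : ∀ i, Λ₀ (bs i) = μ i • bs i) {e₀ : E3} {ν₀ : ℝ} (he : ‖e₀‖ = 1)
    (hev : Λ₀ e₀ = ν₀ • e₀) :
    ∃ g : (E3 →L[ℝ] E3) → E3 × ℝ, g Λ₀ = (e₀, ν₀) ∧ ∀ᶠ Λ in 𝓝 Λ₀,
      Λ (g Λ).1 = (g Λ).2 • (g Λ).1 ∧ ‖(g Λ).1‖ = 1 ∧ ContinuousAt g Λ := by
  let f : (E3 →L[ℝ] E3) → E3 × ℝ → E3 × ℝ := fun Λ z => (Λ z.1 - z.2 • z.1, ‖z.1‖ ^ 2)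
  have hfd : ContDiff ℝ 2 (fun z : (E3 →L[ℝ] E3) × (E3 × ℝ) => f z.1 z.2) := by
    refine ContDiff.prodMk ?_ ((contDiff_norm_sq ℝ).comp (by fun_prop))
    fun_prop
  let f' : (E3 →L[ℝ] E3) × (E3 × ℝ) → E3 × ℝ →L[ℝ] E3 × ℝ := fun z =>
    (fderiv ℝ (fun z : (E3 →L[ℝ] E3) × (E3 × ℝ) => f z.1 z.2) z).comp
      (ContinuousLinearMap.inr ℝ _ _)
  have hf' : ∀ z, HasFDerivAt (f z.1) (f' z) z.2 := fun z =>
    HasFDerivAt.comp (g := fun z : (E3 →L[ℝ] E3) × (E3 × ℝ) => f z.1 z.2) z.2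
      (hfd.differentiable (by simp) (z.1, z.2)).hasFDerivAt (hasFDerivAt_prodMk_right z.1 z.2)
  have hf'' : ∀ Λ e ν h s, f' (Λ, (e, ν)) (h, s) = (Λ h - ν • h - s • e, 2 * inner ℝ e h) := by
    intro Λ e ν h s
    have h1 : HasFDerivAt (fun z : E3 × ℝ => Λ z.1 - z.2 • z.1) _ (e, ν) :=
      (Λ.hasFDerivAt.comp (e, ν) hasFDerivAt_fst).sub
        ((hasFDerivAt_snd (𝕜 := ℝ) (p := (e, ν))).smul hasFDerivAt_fst)
    have h2 : HasFDerivAt (fun z : E3 × ℝ => ‖z.1‖ ^ 2) _ (e, ν) :=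
      HasFDerivAt.comp (g := fun y : E3 => ‖y‖ ^ 2) (f := Prod.fst) (e, ν)
        (hasStrictFDerivAt_norm_sq e).hasFDerivAt hasFDerivAt_fst
    rw [(hf' (Λ, (e, ν))).unique (h1.prodMk h2)]
    simp [sub_sub]
  have he0 : e₀ ≠ 0 := fun h0 => by simp [h0] at he
  obtain ⟨A, hA⟩ := exists_continuousLinearEquiv_of_injective rfl (f' (Λ₀, (e₀, ν₀)))
    (fun z hz => by
      rw [← Prod.mk.eta (p := z), hf'', Prod.mk_eq_zero] at hz
      have := eigenvector_equation_linearized hμ hΛ he0 hev hz.1 (by simpa using hz.2)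
      exact Prod.ext this.1 this.2)
  obtain ⟨g, hg0, hg⟩ := exists_continuousAt_implicit (f := f) (f' := f') (x₀ := Λ₀)
    (e₀ := (e₀, ν₀)) A (Eventually.of_forall hf')
    (by
      rw [hA]
      exact ((hfd.continuous_fderiv (by simp)).clm_comp continuous_const).tendsto _)
    (Eventually.of_forall fun z => (hfd.continuous.comp
      (Continuous.prodMk_left z.2)).continuousAt)
  refine ⟨g, hg0, hg.mono fun Λ hΛg => ?_⟩
  obtain ⟨h1, h2⟩ := hΛg
  simp only [f, Prod.mk.injEq, hev, sub_self, he] at h1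
  refine ⟨sub_eq_zero.1 h1.1, ?_, h2⟩
  exact (sq_eq_sq₀ (norm_nonneg _) zero_le_one).1 h1.2

/-- Along a continuation `q` of a saddle, a tangent unit eigenvector of the linearization
continues to tangent unit eigenvectors. -/
lemma exists_direction_continuation {v₀ : Vect} {q : Vect → S2}
    (h : IsHyperbolicSaddle v₀ (q v₀)) (hq : ∀ᶠ v in 𝓝 v₀, v (q v) = 0 ∧ ContinuousAt q v)
    {e₀ : E3} {ν₀ : ℝ} (he : ‖e₀‖ = 1) (ht : inner ℝ e₀ (q v₀ : E3) = 0)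
    (hev : v₀.linearization (q v₀) e₀ = ν₀ • e₀) :
    ∃ (e : Vect → E3) (ν : Vect → ℝ), e v₀ = e₀ ∧ ν v₀ = ν₀ ∧ ∀ᶠ v in 𝓝 v₀,
      v.linearization (q v) (e v) = ν v • e v ∧ ‖e v‖ = 1 ∧ inner ℝ (e v) (q v : E3) = 0 ∧
      ContinuousAt e v ∧ ContinuousAt ν v := by
  obtain ⟨bs, μ, hμ, hΛ⟩ := h.exists_eigenbasis
  have hν0 : ν₀ ≠ 0 := by
    rintro rfl
    have he0 : e₀ ≠ 0 := fun h0 => by simp [h0] at he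
    -- `e₀` and `q v₀` cannot both belong to the simple eigenvalue `0`
    have := (eigenvector_equation_linearized (s := 0) hμ hΛ he0 hev (h := (q v₀ : E3))
      (by simpa using linearization_coe v₀ (q v₀)) ht).1
    exact coe_ne_zero _ this
  obtain ⟨g, hg0, hg⟩ := exists_eigenvector_continuation hμ hΛ he hev
  let Λ : Vect → E3 →L[ℝ] E3 := fun v => v.linearization (q v)
  have hΛc : ∀ᶠ v in 𝓝 v₀, ContinuousAt Λ v := hq.mono fun v hv =>
    ContinuousAt.comp (f := fun v : Vect => (v, (q v : E3)))
      (g := fun z : Vect × E3 => fderiv ℝ z.1.ext z.2)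
      (continuousAt_fderiv_ext_uncurry v (coe_ne_zero (q v)))
      (continuousAt_id.prodMk (continuous_subtype_val.continuousAt.comp hv.2))
  have hν : ∀ᶠ v in 𝓝 v₀, (g (Λ v)).2 ≠ 0 := by
    have hc : ContinuousAt (fun v => (g (Λ v)).2) v₀ :=
      continuousAt_snd.comp (ContinuousAt.comp (g := g) hg.self_of_nhds.2.2 hΛc.self_of_nhds)
    refine hc.eventually_ne ?_
    rw [show Λ v₀ = v₀.linearization (q v₀) from rfl, hg0]
    exact hν0
  refine ⟨fun v => (g (Λ v)).1, fun v => (g (Λ v)).2, congrArg Prod.fst hg0,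
    congrArg Prod.snd hg0, ?_⟩
  filter_upwards [hΛc, hΛc.self_of_nhds.eventually hg, hq, hν] with v h1 h2 h3 h4
  have hgc : ContinuousAt (fun v => g (Λ v)) v := ContinuousAt.comp (g := g) h2.2.2 h1
  refine ⟨h2.1, h2.2.1, ?_, continuousAt_fst.comp hgc, continuousAt_snd.comp hgc⟩
  have h5 := inner_linearization_coe h3.1 (g (Λ v)).1
  rw [show v.linearization (q v) (g (Λ v)).1 = _ from h2.1, inner_smul_left] at h5
  exact (mul_eq_zero.1 h5).resolve_left (by simpa using h4)

/-- The continuation of a saddle consists of saddles: the eigenvectors `a`, `b` continue, with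
eigenvalues of the same signs. -/
lemma eventually_isHyperbolicSaddle {v₀ : Vect} {q : Vect → S2}
    (h : IsHyperbolicSaddle v₀ (q v₀)) (hq : ∀ᶠ v in 𝓝 v₀, v (q v) = 0 ∧ ContinuousAt q v) :
    ∀ᶠ v in 𝓝 v₀, IsHyperbolicSaddle v (q v) := by
  obtain ⟨-, a, b, lam, mu, ha, hb, hat, hbt, hLa, hLb, hl, hm⟩ := id h
  have norm_one : ∀ {c : E3}, c ≠ 0 → ‖‖c‖⁻¹ • c‖ = 1 := fun hc => by
    simp [norm_smul, hc]
  obtain ⟨a', lam', -, hl0, ha'⟩ := exists_direction_continuation h hq (norm_one ha)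
    (by rw [inner_smul_left, hat, mul_zero])
    (show v₀.linearization (q v₀) _ = lam • _ by rw [map_smul, hLa, smul_comm])
  obtain ⟨b', mu', -, hm0, hb'⟩ := exists_direction_continuation h hq (norm_one hb)
    (by rw [inner_smul_left, hbt, mul_zero])
    (show v₀.linearization (q v₀) _ = mu • _ by rw [map_smul, hLb, smul_comm])
  filter_upwards [hq, ha', hb',
    ha'.self_of_nhds.2.2.2.2.eventually_lt_const (u := 0) (by rwa [hl0]),
    hb'.self_of_nhds.2.2.2.2.eventually_const_lt (u := 0) (by rwa [hm0])] with v h1 h2 h3 h4 h5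
  exact ⟨h1.1, a' v, b' v, lam' v, mu' v, norm_ne_zero_iff.1 (by rw [h2.2.1]; simp),
    norm_ne_zero_iff.1 (by rw [h3.2.1]; simp), h2.2.2.1, h3.2.2.1, h2.1, h3.1, h4, h5⟩

lemma eventually_injective {X Y ι : Type*} [TopologicalSpace X] [TopologicalSpace Y] [T2Space Y]
    [Finite ι] {f : ι → X → Y} {x : X} (hf : ∀ i, ContinuousAt (f i) x)
    (hx : Function.Injective fun i => f i x) :
    ∀ᶠ x' in 𝓝 x, Function.Injective fun i => f i x' := by
  have : ∀ᶠ x' in 𝓝 x, ∀ i j, i ≠ j → f i x' ≠ f j x' := by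
    refine eventually_all.2 fun i => eventually_all.2 fun j => ?_
    by_cases hij : i = j
    · exact Eventually.of_forall fun _ h => absurd hij h
    · exact (((hf i).ne_iff_eventually_ne (hf j)).1 fun h => hij (hx h)).mono fun _ h _ => h
  filter_upwards [this] with x' hx' i j hij
  by_contra hne
  exact hx' i j hne hij

/-- The marking of a vector field extends continuously to all nearby vector fields: the projection
of marked fields to `Vect` has local sections. -/
theorem MarkedField.exists_section {N : ℕ} (v : MarkedField N) :
    ∃ σ : Vect → MarkedField N, σ v.field = v ∧
      ∀ᶠ u in 𝓝 v.field, (σ u).field = u ∧ ContinuousAt σ u := by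
  choose q hq0 hq using fun i => (v.isHyperbolicSaddle i).exists_continuation
  have hsad : ∀ i, IsHyperbolicSaddle v.field (q i v.field) := fun i => by
    rw [hq0]
    exact v.isHyperbolicSaddle i
  have hdir : ∀ i j, ∃ e : Vect → E3, e v.field = v.dir i j ∧ ∀ᶠ u in 𝓝 v.field,
      IsSeparatrixDirection u (q i u) (e u) ∧ ContinuousAt e u := by
    intro i j
    obtain ⟨h1, h2, ν₀, h3⟩ := v.isSeparatrixDirection i j
    rw [← hq0 i] at h2 h3
    obtain ⟨e, ν, he0, -, he⟩ := exists_direction_continuation (hsad i) (hq i) h1 h2 h3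
    exact ⟨e, he0, he.mono fun u hu => ⟨⟨hu.2.1, hu.2.2.1, ν u, hu.1⟩, hu.2.2.2.1⟩⟩
  choose e he0 he using hdir
  let Good : Vect → Prop := fun u =>
    (Function.Injective fun i => q i u) ∧ (∀ i, IsHyperbolicSaddle u (q i u)) ∧
    (∀ i, Function.Injective fun j => e i j u) ∧
    ∀ i j, IsSeparatrixDirection u (q i u) (e i j u)
  have hGood : ∀ᶠ u in 𝓝 v.field, Good u := by
    refine (eventually_injective (fun i => (hq i).self_of_nhds.2) ?_).and
      ((eventually_all.2 fun i => eventually_isHyperbolicSaddle (hsad i) (hq i)).and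
      ((eventually_all.2 fun i => eventually_injective (fun j => (he i j).self_of_nhds.2) ?_).and
      (eventually_all.2 fun i => eventually_all.2 fun j => (he i j).mono fun u hu => hu.1)))
    · simpa only [hq0] using v.saddle_injective
    · simpa only [he0] using v.dir_injective i
  classical
  let σ : Vect → MarkedField N := fun u =>
    if h : Good u then
      { field := u
        saddle := fun i => q i u
        dir := fun i j => e i j u
        saddle_injective := h.1
        isHyperbolicSaddle := h.2.1
        dir_injective := h.2.2.1
        isSeparatrixDirection := h.2.2.2 }
    else v
  have hσ : ∀ u, Good u → ((σ u).field, (σ u).saddle, (σ u).dir) =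
      (u, (fun i => q i u), fun i j => e i j u) := fun u hu => by
    simp only [σ, dif_pos hu]
  refine ⟨σ, ?_, ?_⟩
  · have h1 := hσ _ hGood.self_of_nhds
    simp only [hq0, he0, Prod.mk.injEq] at h1
    obtain ⟨h1, h2, h3⟩ := h1
    revert h1 h2 h3
    generalize σ v.field = w
    cases w
    cases v
    rintro h1 h2 h3
    simp only at h1 h2 h3
    subst h1 h2 h3
    rfl
  · filter_upwards [hGood.eventually_nhds, eventually_all.2 hq,
      eventually_all.2 fun i => eventually_all.2 (he i)] with u h1 h2 h3
    refine ⟨congrArg Prod.fst (hσ u h1.self_of_nhds), ?_⟩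
    have hind : Topology.IsInducing (fun v : MarkedField N => (v.field, v.saddle, v.dir)) := ⟨rfl⟩
    refine hind.continuousAt_iff.2 ?_
    have hc : ContinuousAt (fun u : Vect => (u, (fun i => q i u), fun i j => e i j u)) u :=
      continuousAt_id.prodMk ((continuousAt_pi.2 fun i => (h2 i).2).prodMk
        (continuousAt_pi.2 fun i => continuousAt_pi.2 fun j => (h3 i j).2))
    exact hc.congr (h1.mono fun u' hu' => (hσ u' hu').symm)

/-! ### Realization of germs -/

/-- A continuous linear map onto a finite-dimensional space restricts to an isomorphism of the span
of finitely many vectors from a given dense subspace. -/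
lemma exists_equiv_of_dense {E Y : Type*} [NormedAddCommGroup E] [NormedSpace ℝ E]
    [NormedAddCommGroup Y] [NormedSpace ℝ Y] [FiniteDimensional ℝ Y] {𝒟 : Submodule ℝ E}
    (h𝒟 : Dense (𝒟 : Set E)) {L : E →L[ℝ] Y} (hL : Function.Surjective L) :
    ∃ (l : ℕ) (w : Fin l → E) (A : Rn l ≃L[ℝ] Y), (∀ i, w i ∈ 𝒟) ∧
      ∀ c : Rn l, L (∑ i, c i • w i) = A c := by
  -- the image of `𝒟` is a dense subspace, and subspaces of `Y` are closed
  have himg : Dense ((𝒟.map (L : E →ₗ[ℝ] Y) : Submodule ℝ Y) : Set Y) := by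
    simpa using hL.denseRange.dense_image L.continuous h𝒟
  have hclosed := (𝒟.map (L : E →ₗ[ℝ] Y)).closed_of_finiteDimensional
  have hall : ∀ y : Y, ∃ w ∈ 𝒟, L w = y := fun y => by
    have : y ∈ ((𝒟.map (L : E →ₗ[ℝ] Y) : Submodule ℝ Y) : Set Y) := by
      rw [← hclosed.closure_eq]
      exact himg y
    simpa using this
  let A : Rn (Module.finrank ℝ Y) ≃L[ℝ] Y := ContinuousLinearEquiv.ofFinrankEq (by simp)
  choose w hw hLw using fun i => hall (A (EuclideanSpace.single i 1))
  refine ⟨_, w, A, hw, fun c => ?_⟩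
  have hc : c = ∑ i, c i • EuclideanSpace.single i (1 : ℝ) := by
    ext j
    simp [Pi.single_apply]
  conv_rhs => rw [hc]
  simp only [map_sum, map_smul, hLw]

/-- A submersion `P` at `v` can be inverted along an affine family with directions and origin in a
dense subspace: the origin `u` is a parameter of the equation `P (u + ∑ cᵢ wᵢ) = y` for `c`, and it
can be moved into the dense subspace. The solutions stay where a property that holds near `v` is
true. -/
lemma exists_affine_family {E Y : Type*} [NormedAddCommGroup E] [NormedSpace ℝ E]
    [NormedAddCommGroup Y] [NormedSpace ℝ Y] [FiniteDimensional ℝ Y] {𝒟 : Submodule ℝ E}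
    (h𝒟 : Dense (𝒟 : Set E)) {P : E → Y} {v : E} (hP : ContDiffAt ℝ 1 P v)
    (hs : Function.Surjective (fderiv ℝ P v)) {good : E → Prop} (hgood : ∀ᶠ u in 𝓝 v, good u) :
    ∃ (l : ℕ) (u : E) (w : Fin l → E), u ∈ 𝒟 ∧ (∀ i, w i ∈ 𝒟) ∧
      ∀ᶠ y in 𝓝 (P v), ∃ (c : Rn l) (A : Rn l ≃L[ℝ] Y),
        P (u + ∑ i, c i • w i) = y ∧ good (u + ∑ i, c i • w i) ∧
        HasFDerivAt (fun c : Rn l => P (u + ∑ i, c i • w i)) (A : Rn l →L[ℝ] Y) c := by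
  obtain ⟨l, w, A, hw, hA⟩ := exists_equiv_of_dense h𝒟 hs
  let T : Rn l →L[ℝ] E := ∑ i, (EuclideanSpace.proj i : Rn l →L[ℝ] ℝ).smulRight (w i)
  have hT : ∀ c : Rn l, T c = ∑ i, c i • w i := fun c => by
    simp [T, _root_.sum_apply]
  have hAT : (A : Rn l →L[ℝ] Y) = (fderiv ℝ P v).comp T := by
    ext c
    simp [hT, hA]
  -- the parameters of the equation are the origin `u` and the right-hand side `y`
  let B : (E × Y) × Rn l → E := fun z => z.1.1 + T z.2
  have hB : Continuous B := by fun_prop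
  have hBv : B ((v, P v), 0) = v := by simp [B]
  have hBt : Tendsto B (𝓝 ((v, P v), 0)) (𝓝 v) := by
    simpa only [hBv] using hB.tendsto ((v, P v), 0)
  have hP1 : ∀ᶠ u in 𝓝 v, ContDiffAt ℝ 1 P u := hP.eventually (by simp)
  have hcomp : Tendsto (fun u => (fderiv ℝ P u).comp T) (𝓝 v) (𝓝 ((fderiv ℝ P v).comp T)) :=
    (hP.fderiv_right (m := 0) (by simp)).continuousAt.clm_comp continuousAt_const
  obtain ⟨g, hg0, hg⟩ := exists_continuousAt_implicit
    (f := fun (x : E × Y) c => P (x.1 + T c) - x.2)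
    (f' := fun z => (fderiv ℝ P (B z)).comp T) (x₀ := (v, P v)) (e₀ := 0) A
    ((hBt.eventually hP1).mono fun z hz => by
      have h1 : HasFDerivAt (fun c => z.1.1 + T c) T z.2 := T.hasFDerivAt.const_add _
      exact ((hz.differentiableAt one_ne_zero).hasFDerivAt.comp z.2 h1).sub_const _)
    (by
      rw [hAT]
      exact hcomp.comp hBt)
    ((hBt.eventually hP1).mono fun z hz =>
      (ContinuousAt.comp (f := fun x : E × Y => x.1 + T z.2) hz.continuousAt
        (by fun_prop)).sub continuousAt_snd)
  have hnear : Tendsto (fun x : E × Y => B (x, g x)) (𝓝 (v, P v)) (𝓝 v) := by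
    have hgc : ContinuousAt g (v, P v) := hg.self_of_nhds.2
    have : ContinuousAt (fun x : E × Y => B (x, g x)) (v, P v) :=
      hB.continuousAt.comp (continuousAt_id.prodMk hgc)
    rw [ContinuousAt, hg0, hBv] at this
    exact this
  have hequiv : ∀ᶠ u in 𝓝 v, ∃ A' : Rn l ≃L[ℝ] Y,
      (A' : Rn l →L[ℝ] Y) = (fderiv ℝ P u).comp T := by
    rw [← hAT] at hcomp
    exact hcomp.eventually A.nhds
  have hall : ∀ᶠ x : E × Y in 𝓝 (v, P v), ∃ (c : Rn l) (A : Rn l ≃L[ℝ] Y),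
      P (x.1 + T c) = x.2 ∧ good (x.1 + T c) ∧
      HasFDerivAt (fun c : Rn l => P (x.1 + T c)) (A : Rn l →L[ℝ] Y) c := by
    filter_upwards [hg, hnear.eventually hgood, hnear.eventually hequiv, hnear.eventually hP1]
      with x h1 h2 ⟨A', hA'⟩ h4
    refine ⟨g x, A', ?_, h2, ?_⟩
    · have := h1.1
      simpa [sub_eq_zero] using this
    · rw [hA']
      have h5 : HasFDerivAt (fun c => x.1 + T c) T (g x) := T.hasFDerivAt.const_add _
      exact (h4.differentiableAt one_ne_zero).hasFDerivAt.comp (g x) h5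
  obtain ⟨u, hu, hu𝒟⟩ := hall.curry_nhds.and_frequently (mem_closure_iff_frequently.1 (h𝒟 v))
    |>.exists
  exact ⟨l, u, w, hu𝒟, hw, by simpa only [hT] using hu⟩

/-- A `C^n` map `γ` lifts through a `C^n` local diffeomorphism `Ψ`. -/
lemma exists_lift_of_hasFDerivAt_equiv {E Y Z : Type*} [NormedAddCommGroup E] [NormedSpace ℝ E]
    [CompleteSpace E] [NormedAddCommGroup Y] [NormedSpace ℝ Y] [NormedAddCommGroup Z]
    [NormedSpace ℝ Z] {n : ℕ∞ω} (hn : n ≠ 0) {Ψ : E → Y} {c : E} {A : E ≃L[ℝ] Y}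
    (hΨ : ContDiffAt ℝ n Ψ c) (hA : HasFDerivAt Ψ (A : E →L[ℝ] Y) c) {γ : Z → Y} {z : Z}
    (hγ : ContDiffAt ℝ n γ z) (hz : γ z = Ψ c) :
    ∃ κ : Z → E, ContDiffAt ℝ n κ z ∧ κ z = c ∧ ∀ᶠ z' in 𝓝 z, Ψ (κ z') = γ z' := by
  refine ⟨fun z' => hΨ.localInverse hA hn (γ z'), ?_, ?_, ?_⟩
  · have := hΨ.to_localInverse hA hn
    rw [← hz] at this
    exact this.comp z hγ
  · simp only [hz]
    exact hΨ.localInverse_apply_image hA hn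
  · have := (hΨ.hasStrictFDerivAt' hA hn).eventually_right_inverse
    rw [← hz] at this
    exact hγ.continuousAt.eventually this

lemma eval_add_sum_smul {l : ℕ} (u : Vect) (w : Fin l → Vect) (c : Rn l) (x : S2) :
    (u + ∑ i, c i • w i) x = u x + ∑ i, c i • w i x := by
  let ev : Vect →ₗ[ℝ] E3 :=
    { toFun := fun v => v x
      map_add' := fun v w => Vect.eval_add v w x
      map_smul' := fun a v => Vect.eval_smul a v x }
  change ev (u + ∑ i, c i • w i) = ev u + ∑ i, c i • ev (w i)
  simp

/-- A `C³` map `κ` into the coefficients of a finite-parameter affine family, composed with a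
local section of the projection of marked fields, gives a local family. -/
lemma isLocalFamily_section_comp {N k l : ℕ} {σ : Vect → MarkedField N} {u : Vect}
    {w : Fin l → Vect} {κ : Rn k → Rn l} (hκ : ContDiffAt ℝ 3 κ 0)
    (hσ : ∀ᶠ z in 𝓝 (u + ∑ i, κ 0 i • w i), (σ z).field = z ∧ ContinuousAt σ z) :
    IsLocalFamily (fun α => σ (u + ∑ i, κ α i • w i)) := by
  have hκ' : ∀ᶠ α in 𝓝 (0 : Rn k), ContDiffAt ℝ 3 κ α := hκ.eventually (by decide)
  have hcoord : ∀ i, ∀ α, ContDiffAt ℝ 3 κ α → ContDiffAt ℝ 3 (fun α => κ α i) α := fun i α h =>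
    (EuclideanSpace.proj i : Rn l →L[ℝ] ℝ).contDiff.contDiffAt.comp α h
  have hβ : ∀ α, ContDiffAt ℝ 3 κ α → ContinuousAt (fun α => u + ∑ i, κ α i • w i) α :=
    fun α h => continuousAt_const.add (tendsto_finsetSum _ fun i _ =>
      (hcoord i α h).continuousAt.smul continuousAt_const)
  have hev := (hβ 0 hκ).eventually hσ
  refine ⟨?_, ?_⟩
  · filter_upwards [hκ', hev] with α h1 h2
    exact ContinuousAt.comp (g := σ) h2.2 (hβ α h1)
  · filter_upwards [hκ', hev.eventually_nhds] with α h1 h2 x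
    have hsum : ContMDiffAt (𝓘(ℝ, Rn k).prod (𝓡 2)) 𝓘(ℝ, E3) 3
        (fun p : Rn k × S2 => u p.2 + ∑ i, κ p.1 i • w i p.2) (α, x) := by
      refine ContMDiffAt.add (ContMDiffAt.comp (α, x) (u.contMDiff x) contMDiffAt_snd)
        (contMDiffAt_finsetSum fun i _ => ?_)
      exact ContMDiffAt.smul
        (ContMDiffAt.comp (α, x) (hcoord i α h1).contMDiffAt contMDiffAt_fst)
        (ContMDiffAt.comp (α, x) ((w i).contMDiff x) contMDiffAt_snd)
    refine hsum.congr_of_eventuallyEq ?_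
    have hfst : Tendsto (Prod.fst : Rn k × S2 → Rn k) (𝓝 (α, x)) (𝓝 α) := continuousAt_fst
    filter_upwards [hfst.eventually h2] with p hp
    rw [hp.1, eval_add_sum_smul]

/-- Every germ with value at `0` in a suitable open set is the invariant germ of a transverse family,
the homeomorphism of the domains being the identity. -/
theorem exists_open_forall_realized {N m D d : ℕ} {𝒟 : Submodule ℝ Vect}
    (h𝒟 : Dense (𝒟 : Set Vect)) {M : Set (MarkedField N)} (hMne : M.Nonempty)
    {φ : Fin D → MarkedField N → ℝ} (hind : IndependentOn 𝒟 M m φ) :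
    ∃ U : Set (Rn D), IsOpen U ∧ U.Nonempty ∧
      ∀ (T : Set (Rn (d + m))) (g : Rn (d + m) → Rn D),
        IsSubmanifoldGerm 3 d T → IsSmoothGermOn 3 T g → g 0 ∈ U →
        ∃ V ∈ transverseFamilies M m (d + m),
          GermEquivalent T g (V ⁻¹' M) (fun α => vectorOf φ (V α)) := by
  obtain ⟨v, hv⟩ := hMne
  obtain ⟨σ, hσv, hσ⟩ := v.exists_section
  obtain ⟨F, G, ⟨hF1, WF, hWF, hF3⟩, hF, ⟨hG1, WG, hWG, hG3⟩, hφG, hGs⟩ := hind v hv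
  have hσc : Tendsto σ (𝓝 v.field) (𝓝 v) := by
    simpa only [ContinuousAt, hσv] using hσ.self_of_nhds.2
  let P : Vect → Rn m × Rn D := fun u => (F u, G u)
  have hP : ContDiffAt ℝ 1 P v.field := hF1.prodMk hG1
  have hPs : Function.Surjective (fderiv ℝ P v.field) := by
    have hfd : fderiv ℝ P v.field = (fderiv ℝ F v.field).prod (fderiv ℝ G v.field) :=
      (hF1.differentiableAt one_ne_zero).fderiv_prodMk (hG1.differentiableAt one_ne_zero)
    rintro ⟨y, y'⟩
    obtain ⟨a, ha⟩ := hF.2.1 y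
    obtain ⟨b, hb, hb'⟩ := hGs (y' - fderiv ℝ G v.field a)
    refine ⟨a + b, ?_⟩
    rw [hfd]
    simp [ha, hb, hb']
  let good : Vect → Prop := fun u => u ∈ WF ∧ u ∈ WG ∧ IsDefiningMap M m (σ u) F ∧
    (∀ᶠ z in 𝓝 (σ u), z ∈ M → vectorOf φ z = G z.field) ∧
    ∀ᶠ z in 𝓝 u, (σ z).field = z ∧ ContinuousAt σ z
  have hgood : ∀ᶠ u in 𝓝 v.field, good u := by
    filter_upwards [hWF, hWG, hσc.eventually hF.eventually, hσc.eventually hφG.eventually_nhds,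
      hσ.eventually_nhds] with u h1 h2 h3 h4 h5
    exact ⟨h1, h2, h3, h4, h5⟩
  obtain ⟨l, u, w, hu, hw, hsolve⟩ := exists_affine_family h𝒟 hP hPs hgood
  have hF0 : F v.field = 0 := hF.2.2.self_of_nhds.1 hv
  have hslice : Tendsto (fun y : Rn D => ((0 : Rn m), y)) (𝓝 (G v.field)) (𝓝 (P v.field)) := by
    have : Continuous (fun y : Rn D => ((0 : Rn m), y)) := by fun_prop
    simpa only [P, hF0] using this.tendsto (G v.field)
  obtain ⟨U, hU, hUo, hUG⟩ := _root_.mem_nhds_iff.1 (hslice.eventually hsolve)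
  refine ⟨U, hUo, ⟨_, hUG⟩, ?_⟩
  rintro T g ⟨h0T, c, hc, FT, hFT, hFTs, hTF⟩ ⟨g', hg', hgg'⟩ hg0
  obtain rfl : c = m := by omega
  have hg0' : g 0 = g' 0 := hgg'.self_of_nhdsWithin h0T
  obtain ⟨c₀, A, hPc, ⟨hcF, hcG, hdef, hcφ, hcσ⟩, hA⟩ := hU hg0
  obtain ⟨κ, hκ, hκ0, hPκ⟩ := exists_lift_of_hasFDerivAt_equiv (n := 3) (by simp)
    ((hF3 l u w hu hw c₀ hcF).prodMk (hG3 l u w hu hw c₀ hcG)) hA (hFT.prodMk hg')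
    (by rw [← hg0', hTF.self_of_nhds.1 h0T]; exact hPc.symm)
  rw [← hκ0] at hdef hcφ hcσ
  have hV := isLocalFamily_section_comp hκ hcσ
  set V : Rn (d + c) → MarkedField N := fun α => σ (u + ∑ i, κ α i • w i) with hVdef
  have hβ : ContDiffAt ℝ 3 (fun α => u + ∑ i, κ α i • w i) 0 :=
    contDiffAt_const.add (ContDiffAt.sum fun i _ =>
      ((EuclideanSpace.proj i : Rn l →L[ℝ] ℝ).contDiff.contDiffAt.comp (0 : Rn (d + c)) hκ).smul
        contDiffAt_const)
  have hfield : ∀ᶠ α in 𝓝 (0 : Rn (d + c)), (V α).field = u + ∑ i, κ α i • w i :=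
    (hβ.continuousAt.eventually hcσ).mono fun α h => h.1
  have hFV : ∀ᶠ α in 𝓝 (0 : Rn (d + c)), F (V α).field = FT α := by
    filter_upwards [hfield, hPκ] with α h1 h2
    rw [h1]
    exact congrArg Prod.fst h2
  have hGV : ∀ᶠ α in 𝓝 (0 : Rn (d + c)), G (V α).field = g' α := by
    filter_upwards [hfield, hPκ] with α h1 h2
    rw [h1]
    exact congrArg Prod.snd h2
  have hTV : ∀ᶠ α in 𝓝 (0 : Rn (d + c)), α ∈ T ↔ V α ∈ M := by
    filter_upwards [hTF, hFV, hV.continuousAt.eventually hdef.2.2] with α h1 h2 h3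
    rw [h1, h3, h2]
  refine ⟨V, ⟨hV, isTransverse_of_surjective_fderiv (F := F) (hTV.self_of_nhds.1 h0T)
    ((hβ.of_le (by norm_num)).congr_of_eventuallyEq hfield) hdef ?_⟩, ?_⟩
  · rw [EventuallyEq.fderiv_eq hFV]
    exact hFTs
  · refine germEquivalent_of_openPartialHomeomorph (OpenPartialHomeomorph.refl _) (Set.mem_univ _)
      rfl hTV ?_
    filter_upwards [hTV, hGV, hV.continuousAt.eventually hcφ,
      eventually_nhdsWithin_iff.1 hgg'] with α h1 h2 h3 h4 hα
    change vectorOf φ (V α) = g α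
    rw [h3 (h1.1 hα), h2, h4 hα]

end PlanarFamilies

open PlanarFamilies
theorem mainTheorem8 (N : ℕ) (𝒟 : Submodule ℝ Vect) (h𝒟 : Dense (𝒟 : Set Vect))
    (M : Set (MarkedField N)) (m : ℕ) (hMne : M.Nonempty)
    (hM : IsBanachSubmanifold 𝒟 M m) (hMtop : TopologicallyDistinguished M)
    (D : ℕ) (hD : 1 < D) (φ : Fin D → MarkedField N → ℝ)
    (hφ : ∀ j, RobustlyInvariant M m (φ j)) (hind : IndependentOn 𝒟 M m φ)
    (d : ℕ) (hd : 0 < d) (hdD : d < D) :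
    AdmitsFunctionalInvariant (transverseFamilies M m (d + m)) d D ∧
    IsFunctionalInvariant (transverseFamilies M m (d + m)) d D
      (fun V => V ⁻¹' M) (fun V α => vectorOf φ (V α)) := by
  suffices h : IsFunctionalInvariant (transverseFamilies M m (d + m)) d D
      (fun V => V ⁻¹' M) (fun V α => vectorOf φ (V α)) from ⟨⟨_, _, h⟩, h⟩
  refine ⟨fun V hV => ⟨isSubmanifoldGerm_preimage hV, ?_⟩, fun V hV V' hV' hVV' =>
    germEquivalent_of_familiesEquivalent (Nat.le_add_left m d) hMtop hφ hV hV' hVV',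
    exists_open_forall_realized h𝒟 hMne hind⟩
  obtain ⟨F, G, -, -, hG, hφG, -⟩ := hind (V 0) hV.2.1
  exact isSmoothGermOn_preimage hV hG.1 hφG
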